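/- Let $\mathscr A$ be a unital $C^*$-algebra with a faithful tracial state $\varphi$ (for instance a von Neumann algebra with a faithful, normal tracial state), and let $S=(S_t)_{t\ge 0}$ be a free Brownian motion in $(\mathscr A,\varphi)$: each $S_t$ is self-adjoint, $S_0=0$, for $0\le s<t$ the increment $S_t-S_s$ has the centred semicircular law of variance $t-s$ (density $\frac{1}{2\pi(t-s)}\sqrt{4(t-s)-x^2}$ on $|x|\le 2\sqrt{t-s}$), and increments over consecutive intervals $[t_0,t_1],[t_1,t_2],\dots,[t_{m-1},t_m]$ with $0\le t_0<t_1<\dots<t_m$ are freely independent. For $n\ge 1$, the Wigner integral $I_n^S(f)$ of $f\in L^2(\mathbb R_+^n)$ (complex valued) is defined by $I_n^S(\mathbf 1_{[s_1,t_1]\times\cdots\times[s_n,t_n]})=(S_{t_1}-S_{s_1})\cdots(S_{t_n}-S_{s_n})$ for pairwise disjoint intervals $[s_1,t_1],\dots,[s_n,t_n]\subset\mathbb R_+$, by linearity on the span of such indicators, and by continuity from $L^2(\mathbb R_+^n)$ to the norm $\|X\|_\varphi=\varphi(X^*X)^{1/2}$. Put $|X|^4=(XX^*)^2$, $f^*(t_1,\dots,t_n)=\overline{f(t_n,\dots,t_1)}$,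 and, for $f,g\in L^2(\mathbb R_+^n)$ and $0\le p\le n$, $$ (f\overset{p}{\frown} g)(t_1,\dots,t_{2n-2p})=\int_{\mathbb R_+^p} f(t_1,\dots,t_{n-p},s_1,\dots,s_p)\,g(s_p,\dots,s_1,t_{n-p+1},\dots,t_{2n-2p})\,ds_1\cdots ds_p ,$$ which is an element of $L^2(\mathbb R_+^{2n-2p})$. **Theorem.** Let $n\ge 1$ be an integer and let $(f_k)_{k\in\mathbb N}$ be a sequence in $L^2(\mathbb R_+^n)$ with $\|f_k\|_{L^2(\mathbb R_+^n)}=1$ for all $k$. Then each $I_n^S(f_k)$ is given by a unique element of $\mathscr A$, for every $k$ $$\varphi\big(|I_n^S(f_k)|^4\big)=2+\sum_{p=1}^{n-1}\big\|f_k\overset{p}{\frown} f_k^*\big\|_{L^2(\mathbb R_+^{2n-2p})}^2 ,$$ and the following are equivalent: 1. $\lim_{k\to\infty}\varphi\big(|I_n^S(f_k)|^4\big)=2$; 2. for each $p=1,2,\dots,n-1$, $\lim_{k\to\infty} f_k\overset{p}{\frown} f_k^*=0$ in $L^2(\mathbb R_+^{2n-2p})$. -/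

import Mathlib

open MeasureTheory Filter Topology
open scoped ComplexOrder NNReal

noncomputable section

namespace FreeProb

/-! ### The spaces `L²(ℝ₊ⁿ)` and the nested contractions -/

/-- Lebesgue measure on the half line `ℝ₊ = [0, ∞)`, as a measure on `ℝ`. -/
abbrev halfLine : Measure ℝ := volume.restrict (Set.Ici 0)

/-- Lebesgue measure on `ℝ₊ⁿ`, as a measure on `Fin n → ℝ`. -/
abbrev orthant (n : ℕ) : Measure (Fin n → ℝ) := Measure.pi fun _ => halfLine

/-- The complex Hilbert space `L²(ℝ₊ⁿ)`. -/
abbrev L2 (n : ℕ) : Type := Lp ℂ 2 (orthant n)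

/-- Reversal of the order of the variables, `(t₁, …, tₙ) ↦ (tₙ, …, t₁)`. -/
def reverse {n : ℕ} (t : Fin n → ℝ) : Fin n → ℝ := fun i => t i.rev

lemma measurePreserving_reverse (n : ℕ) :
    MeasurePreserving (reverse (n := n)) (orthant n) (orthant n) := by
  have h := measurePreserving_piCongrLeft (α := fun _ : Fin n => ℝ)
    (fun _ : Fin n => halfLine) Fin.revPerm
  convert h using 1
  ext t i
  have := MeasurableEquiv.piCongrLeft_apply_apply (β := fun _ : Fin n => ℝ) Fin.revPerm t i.rev
  simp at this
  simp [reverse, this]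

/-- The adjoint kernel `f*(t₁, …, tₙ) = conj (f (tₙ, …, t₁))`. -/
def adjoint {n : ℕ} (f : L2 n) : L2 n :=
  star (Lp.compMeasurePreserving reverse (measurePreserving_reverse n) f)

/-- `(x₁, …, x_a, y₁, …, y_b)` as a point with `n = a + b` coordinates. -/
def glue {a b n : ℕ} (h : a + b = n) (x : Fin a → ℝ) (y : Fin b → ℝ) : Fin n → ℝ :=
  fun i => Fin.append x y (Fin.cast h.symm i)

/-- The nested integral
`(t₁, …, t_{n+m-2p}) ↦ ∫ f(t₁, …, t_{n-p}, s₁, …, s_p)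
  g(s_p, …, s₁, t_{n-p+1}, …, t_{n+m-2p}) ds₁ ⋯ ds_p` over `ℝ₊ᵖ`, for `p ≤ n` and `p ≤ m`;
the number of free variables `n + m - 2p` is written `(n - p) + (m - p)`. -/
def nestedIntegral {n m p : ℕ} (hn : p ≤ n) (hm : p ≤ m)
    (f : (Fin n → ℝ) → ℂ) (g : (Fin m → ℝ) → ℂ) (t : Fin ((n - p) + (m - p)) → ℝ) : ℂ :=
  ∫ s, f (glue (Nat.sub_add_cancel hn) (fun i => t (Fin.castAdd (m - p) i)) s) *
    g (glue (Nat.add_sub_cancel' hm) (reverse s) (fun j => t (Fin.natAdd (n - p) j))) ∂(orthant p)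

lemma measurePreserving_glue {a b n : ℕ} (h : a + b = n) :
    MeasurePreserving (fun z : (Fin a → ℝ) × (Fin b → ℝ) => glue h z.1 z.2)
      ((orthant a).prod (orthant b)) (orthant n) := by
  subst h
  have h1 := measurePreserving_sumPiEquivProdPi_symm (X := fun _ : Fin a ⊕ Fin b => ℝ)
    (fun _ => halfLine)
  have h2 := measurePreserving_piCongrLeft (α := fun _ : Fin (a + b) => ℝ)
    (fun _ => halfLine) finSumFinEquiv
  convert h2.comp h1 using 1
  ext z i
  have key : ∀ j : Fin a ⊕ Fin b, ∀ w : Fin a ⊕ Fin b → ℝ,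
      MeasurableEquiv.piCongrLeft (fun _ : Fin (a + b) => ℝ) finSumFinEquiv w
        (finSumFinEquiv j) = w j := fun j w =>
    MeasurableEquiv.piCongrLeft_apply_apply (β := fun _ : Fin (a + b) => ℝ) finSumFinEquiv w j
  obtain ⟨j, rfl⟩ := finSumFinEquiv.surjective i
  rw [Function.comp_apply, key]
  rcases j with j | j <;> simp [glue, MeasurableEquiv.sumPiEquivProdPi,
    Equiv.sumPiEquivProdPi]

lemma measurePreserving_split (a b : ℕ) :
    MeasurePreserving (fun t : Fin (a + b) → ℝ =>
        ((fun i => t (Fin.castAdd b i), fun j => t (Fin.natAdd a j)) :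
          (Fin a → ℝ) × (Fin b → ℝ)))
      (orthant (a + b)) ((orthant a).prod (orthant b)) := by
  have h := measurePreserving_glue (rfl : a + b = a + b)
  refine ⟨by fun_prop, ?_⟩
  rw [← h.map_eq, Measure.map_map (by fun_prop) h.measurable]
  convert Measure.map_id using 2
  ext z i <;> simp [glue]

/-- Integration of the middle variable maps `L² × L²` to `L²`. -/
lemma memLp_integral_mul {α β γ : Type*} [MeasurableSpace α] [MeasurableSpace β]
    [MeasurableSpace γ] {μ : Measure α} {ν : Measure β} {ρ : Measure γ}
    [SFinite μ] [SFinite ν] [SFinite ρ] {u : α × γ → ℂ} {v : γ × β → ℂ}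
    (hu : StronglyMeasurable u) (hv : StronglyMeasurable v)
    (hu2 : MemLp u 2 (μ.prod ρ)) (hv2 : MemLp v 2 (ρ.prod ν)) :
    MemLp (fun z : α × β => ∫ s, u (z.1, s) * v (s, z.2) ∂ρ) 2 (μ.prod ν) := by
  have hum := hu.measurable
  have hvm := hv.measurable
  have hmeas : StronglyMeasurable fun z : α × β => ∫ s, u (z.1, s) * v (s, z.2) ∂ρ := by
    apply StronglyMeasurable.integral_prod_right'
      (f := fun q : (α × β) × γ => u (q.1.1, q.2) * v (q.2, q.1.2))
    exact (by fun_prop : Measurable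
      fun q : (α × β) × γ => u (q.1.1, q.2) * v (q.2, q.1.2)).stronglyMeasurable
  refine ⟨hmeas.aestronglyMeasurable, ?_⟩
  have hU := lintegral_rpow_enorm_lt_top_of_eLpNorm_lt_top (by norm_num) (by norm_num) hu2.2
  have hV := lintegral_rpow_enorm_lt_top_of_eLpNorm_lt_top (by norm_num) (by norm_num) hv2.2
  rw [eLpNorm_lt_top_iff_lintegral_rpow_enorm_lt_top (by norm_num) (by norm_num)]
  rw [lintegral_prod _ (by fun_prop)] at hU
  rw [lintegral_prod_symm _ (by fun_prop)] at hV
  simp only [ENNReal.toReal_ofNat] at hU hV ⊢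
  refine lt_of_le_of_lt ?_ (ENNReal.mul_lt_top hU hV)
  rw [← lintegral_prod_mul (by fun_prop) (by fun_prop)]
  refine lintegral_mono fun z => ?_
  have h1 : ‖∫ s, u (z.1, s) * v (s, z.2) ∂ρ‖ₑ ≤
      (∫⁻ s, ‖u (z.1, s)‖ₑ ^ (2 : ℝ) ∂ρ) ^ (1 / 2 : ℝ) *
        (∫⁻ s, ‖v (s, z.2)‖ₑ ^ (2 : ℝ) ∂ρ) ^ (1 / 2 : ℝ) := by
    refine (enorm_integral_le_lintegral_enorm _).trans ?_
    simp only [enorm_mul]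
    exact ENNReal.lintegral_mul_le_Lp_mul_Lq ρ Real.HolderConjugate.two_two
      (by fun_prop) (by fun_prop)
  refine (ENNReal.rpow_le_rpow h1 (by norm_num)).trans (le_of_eq ?_)
  rw [ENNReal.mul_rpow_of_nonneg _ _ (by norm_num), ← ENNReal.rpow_mul, ← ENNReal.rpow_mul]
  norm_num

lemma memLp_nestedIntegral {n m p : ℕ} (hn : p ≤ n) (hm : p ≤ m) (f : L2 n) (g : L2 m) :
    MemLp (nestedIntegral hn hm f g) 2 (orthant ((n - p) + (m - p))) := by
  have h1 := measurePreserving_glue (Nat.sub_add_cancel hn)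
  have h2 : MeasurePreserving (fun z : (Fin p → ℝ) × (Fin (m - p) → ℝ) =>
      glue (Nat.add_sub_cancel' hm) (reverse z.1) z.2)
      ((orthant p).prod (orthant (m - p))) (orthant m) :=
    (measurePreserving_glue (Nat.add_sub_cancel' hm)).comp
      ((measurePreserving_reverse p).prod (MeasurePreserving.id _))
  have h3 := memLp_integral_mul ((Lp.stronglyMeasurable f).comp_measurable h1.measurable)
    ((Lp.stronglyMeasurable g).comp_measurable h2.measurable)
    ((Lp.memLp f).comp_measurePreserving h1) ((Lp.memLp g).comp_measurePreserving h2)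
  have h4 := h3.comp_measurePreserving (measurePreserving_split (n - p) (m - p))
  exact h4

/-- The `p`-th (nested) contraction of `f ∈ L²(ℝ₊ⁿ)` and `g ∈ L²(ℝ₊ᵐ)`, an element of
`L²(ℝ₊^{n+m-2p})`. It is meant for `p ≤ min n m`, and set to `0` otherwise. -/
def contraction {n m : ℕ} (p : ℕ) (f : L2 n) (g : L2 m) : L2 ((n - p) + (m - p)) :=
  if h : p ≤ n ∧ p ≤ m then (memLp_nestedIntegral h.1 h.2 f g).toLp _ else 0

/-! ### Free probability -/

section

variable {A : Type*} [CStarAlgebra A]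

/-- `φ` is a faithful tracial state on the unital C⋆-algebra `A`. -/
structure IsFaithfulTrace (φ : A →ₗ[ℂ] ℂ) : Prop where
  map_one : φ 1 = 1
  nonneg : ∀ a, 0 ≤ φ (star a * a)
  faithful : ∀ a, φ (star a * a) = 0 → a = 0
  trace : ∀ a b, φ (a * b) = φ (b * a)

/-- Free independence of a family of unital subalgebras: a nonempty product of centred elements
vanishes under `φ` as soon as neighbouring factors come from different members of the family. -/
def FreeSubalgebras (φ : A →ₗ[ℂ] ℂ) {ι : Type*} (B : ι → Subalgebra ℂ A) : Prop :=
  ∀ (m : ℕ) (c : Fin (m + 1) → ι) (a : Fin (m + 1) → A),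
    (∀ j : Fin m, c j.castSucc ≠ c j.succ) → (∀ j, a j ∈ B (c j)) → (∀ j, φ (a j) = 0) →
      φ (List.ofFn a).prod = 0

/-- Free independence of a family of (self-adjoint) random variables: the unital algebras that
they generate are freely independent. -/
def FreelyIndependent (φ : A →ₗ[ℂ] ℂ) {ι : Type*} (X : ι → A) : Prop :=
  FreeSubalgebras φ fun i => Algebra.adjoin ℂ {X i}

/-- The centred semicircular distribution `S(0, t)` of variance `t > 0`, with density
`(2πt)⁻¹ √(4t - x²)` on `|x| ≤ 2√t`; `Real.sqrt` vanishes at negative arguments, so the density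
vanishes elsewhere. -/
def semicircular (t : ℝ) : Measure ℝ :=
  volume.withDensity fun x => ENNReal.ofReal (1 / (2 * Real.pi * t) * √(4 * t - x ^ 2))

/-- The self-adjoint element `X` has the (compactly supported) law `μ`: all moments agree. -/
def HasDistribution (φ : A →ₗ[ℂ] ℂ) (X : A) (μ : Measure ℝ) : Prop :=
  ∀ k : ℕ, φ (X ^ k) = ((∫ x, x ^ k ∂μ : ℝ) : ℂ)

/-- `S` is a free Brownian motion in `(A, φ)`. -/
structure IsFreeBrownianMotion (φ : A →ₗ[ℂ] ℂ) (S : ℝ≥0 → A) : Prop where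
  selfAdjoint : ∀ t, IsSelfAdjoint (S t)
  zero : S 0 = 0
  law : ∀ s t, s < t → HasDistribution φ (S t - S s) (semicircular (t - s))
  free : ∀ (m : ℕ) (t : Fin (m + 1) → ℝ≥0), StrictMono t →
    FreelyIndependent φ fun j : Fin m => S (t j.succ) - S (t j.castSucc)

/-- The graph of the Wigner integral on off-diagonal step functions: the linear span of the pairs
`(1_{[s₁,t₁] × ⋯ × [sₙ,tₙ]}, (S_{t₁} - S_{s₁}) ⋯ (S_{tₙ} - S_{sₙ}))`, where `[s₁,t₁], …, [sₙ,tₙ]`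
are pairwise disjoint intervals in `ℝ₊`. -/
def stepGraph (S : ℝ≥0 → A) (n : ℕ) : Submodule ℂ (L2 n × A) :=
  Submodule.span ℂ {z | ∃ s t : Fin n → ℝ≥0, (∀ i, s i ≤ t i) ∧
    Pairwise (fun i j => Disjoint (Set.Icc (s i) (t i)) (Set.Icc (s j) (t j))) ∧
    z.1 =ᵐ[orthant n]
      (Set.univ.pi fun i => Set.Icc (s i : ℝ) (t i : ℝ)).indicator (fun _ => (1 : ℂ)) ∧
    z.2 = (List.ofFn fun i => S (t i) - S (s i)).prod}

/-- `X` is the Wigner integral `Iₙ^S(f)`: there are off-diagonal step functions converging to `f`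
in `L²(ℝ₊ⁿ)` whose Wigner integrals converge to `X` in the norm `‖Y‖ = φ(Y* Y)^{1/2}`. -/
def IsWignerIntegral (φ : A →ₗ[ℂ] ℂ) (S : ℝ≥0 → A) {n : ℕ} (f : L2 n) (X : A) : Prop :=
  ∃ z : ℕ → L2 n × A, (∀ j, z j ∈ stepGraph S n) ∧
    Tendsto (fun j => (z j).1) atTop (𝓝 f) ∧
    Tendsto (fun j => φ (star ((z j).2 - X) * ((z j).2 - X))) atTop (𝓝 0)

open Classical in
/-- The Wigner integral `Iₙ^S(f)`, as an element of `A` (and `0` if there is no such element). -/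
def wignerIntegral (φ : A →ₗ[ℂ] ℂ) (S : ℝ≥0 → A) {n : ℕ} (f : L2 n) : A :=
  if h : ∃ X, IsWignerIntegral φ S f X then h.choose else 0

end

end FreeProb

end

open FreeProb

namespace FreeProb

/-! ### Wick words -/

/-! Along a finite partition the normalized increments of `S` are free standard semicircular
elements. A Wick word corrects the product of its letters so that all nonempty words are centred:
equal neighbours group into blocks, each block is a Chebyshev polynomial of one variable, centred
for the semicircle law, and freeness kills alternating products of such blocks. Two Wick words
multiply by successively cancelling equal letters at the seam. Tensors of normalized indicators
contract by exactly the same rule, because integrating out a pair of variables gives a Kronecker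
delta. Hence the map `chaos` from tensors to Wick words is an isometry into `L²(φ)`, different
degrees are orthogonal, and `I(f) I(g) = ∑ₚ I(f ⌢ₚ g)` (`chaos_mul_chaos`).

With `g = f*` the summands have the distinct degrees `2n - 2p`, so `φ(|I(f)|⁴) = ∑ₚ ‖f ⌢ₚ f*‖²` over
`0 ≤ p ≤ n`. The terms `p = 0` and `p = n` equal `‖f‖⁴` each, which is the constant 2 for unit
kernels. The equivalence is then the fact that a finite sum of nonnegative terms tends to zero iff
every term does.

On off-diagonal boxes no two letters coincide, Wick words are plain products, and `chaos` agrees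
with the Wigner integral. To reach arbitrary kernels one needs density of off-diagonal step
functions (diagonals are null sets) and Haagerup's inequality `‖I(f)‖ ≤ (n + 1) ‖f‖`
(`norm_chaos_le`). The latter gives convergence in operator norm, so the integral lies in the
algebra and the fourth moment passes to the limit. -/

lemma FreeSubalgebras.map_list_prod {A ι : Type*} [CStarAlgebra A] {φ : A →ₗ[ℂ] ℂ} {B : ι → Subalgebra ℂ A}
    (h : FreeSubalgebras φ B) (L : List (ι × A)) (hL : L ≠ [])
    (hc : L.IsChain fun x y => x.1 ≠ y.1) (hB : ∀ x ∈ L, x.2 ∈ B x.1 ∧ φ x.2 = 0) :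
    φ (L.map Prod.snd).prod = 0 := by
  obtain ⟨m, hm⟩ := Nat.exists_eq_succ_of_ne_zero (mt List.length_eq_zero_iff.1 hL)
  have key := h m (fun j => (L.get (Fin.cast hm.symm j)).1)
    (fun j => (L.get (Fin.cast hm.symm j)).2) ?_ (fun j => (hB _ (List.get_mem _ _)).1)
    (fun j => (hB _ (List.get_mem _ _)).2)
  · convert key using 3
    apply List.ext_get
    · simp [hm]
    · intro k h1 h2
      simp [-List.ofFn_succ]
  · intro j
    have := List.isChain_iff_getElem.1 hc j (by have := j.2; omega)
    simpa using this

section WickWords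

variable {A ι : Type*} [CStarAlgebra A] [DecidableEq ι]

/-- The Wick polynomial of the word `w` in the variables `X`, determined by
`W [] = 1` and `X i * W w = W (i :: w) + [w = i :: w'] W w'`. -/
def wick (X : ι → A) : List ι → A
  | [] => 1
  | [i] => X i
  | i :: j :: w => X i * wick X (j :: w) - if i = j then wick X w else 0

lemma wick_nil (X : ι → A) : wick X [] = 1 := by rw [wick]

lemma wick_singleton (X : ι → A) (i : ι) : wick X [i] = X i := by rw [wick]

lemma wick_cons_cons (X : ι → A) (i j : ι) (w : List ι) :
    wick X (i :: j :: w) = X i * wick X (j :: w) - if i = j then wick X w else 0 := by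
  rw [wick]

lemma mul_wick_cons (X : ι → A) (i j : ι) (w : List ι) :
    X i * wick X (j :: w) = wick X (i :: j :: w) + if i = j then wick X w else 0 := by
  rw [wick_cons_cons]; simp

/-- Left multiplication by a letter gives the same two-step recursion in `a` on both sides. The
singleton `a = [k]` is separate because there the correction term removes the seam letter `i`
itself. -/
lemma wick_concat_mul_cons (X : ι → A) (i j : ι) (v : List ι) : ∀ a : List ι,
    wick X (a ++ [i]) * wick X (j :: v) =
      wick X (a ++ i :: j :: v) + if i = j then wick X a * wick X v else 0
  | [] => by
    simp [wick_singleton, mul_wick_cons, wick_nil]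
  | [k] => by
    have h := wick_concat_mul_cons X i j v []
    simp only [List.nil_append, wick_nil, one_mul, wick_singleton] at h
    simp only [List.cons_append, List.nil_append, wick_cons_cons X k i, wick_singleton, sub_mul,
      mul_assoc, h]
    by_cases hij : i = j
    · subst hij
      by_cases hk : k = i
      · subst hk
        simp [mul_add, wick_nil]
        abel
      · simp [hk, mul_add]
    · by_cases hk : k = i
      · subst hk
        simp [wick_nil, hij]
      · simp [hk, hij]
  | k :: l :: b => by
    have h1 := wick_concat_mul_cons X i j v b
    have h2 := wick_concat_mul_cons X i j v (l :: b)
    simp only [List.cons_append] at h2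
    simp only [List.cons_append, wick_cons_cons X k l, sub_mul, mul_assoc, h2, mul_add, ite_mul,
      h1, zero_mul]
    by_cases hij : i = j <;> by_cases hk : k = l <;> simp [hij, hk]
    all_goals abel

/-- The product formula for Wick words. -/
lemma wick_reverse_mul_wick (X : ι → A) : ∀ u v : List ι,
    wick X u.reverse * wick X v =
      ∑ p ∈ Finset.range (min u.length v.length + 1),
        if u.take p = v.take p then wick X ((u.drop p).reverse ++ v.drop p) else 0
  | [], v => by simp [wick_nil]
  | i :: u, [] => by simp [wick_nil]
  | i :: u, j :: v => by
    have ih := wick_reverse_mul_wick X u v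
    rw [List.reverse_cons, wick_concat_mul_cons, ih]
    simp only [List.length_cons]
    rw [Nat.succ_min_succ, Finset.sum_range_succ' _ (min u.length v.length).succ]
    simp only [List.take_succ_cons, List.drop_succ_cons, List.cons.injEq]
    rw [add_comm]
    congr 1
    · by_cases hij : i = j <;> simp [hij]
    · simp

/-- The recursion that defines Wick words from the left also holds from the right: this is
`wick_concat_mul_cons` with `v = []`. -/
lemma star_wick {X : ι → A} (hX : ∀ i, IsSelfAdjoint (X i)) : ∀ w : List ι,
    star (wick X w) = wick X w.reverse
  | [] => by simp [wick_nil]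
  | [i] => by simp [wick_singleton, (hX i).star_eq]
  | i :: j :: w => by
    have h := wick_concat_mul_cons X j i [] w.reverse
    rw [wick_cons_cons, star_sub, star_mul, star_wick hX (j :: w), (hX i).star_eq]
    simp only [wick_singleton, wick_nil, mul_one] at h
    simp only [List.reverse_cons, List.append_assoc, List.cons_append, List.nil_append]
    rw [h]
    have h2 := star_wick hX w
    by_cases hij : i = j
    · subst hij; simp [h2]
    · simp [hij, Ne.symm hij]

/-- On constant words the Wick recursion is the Chebyshev recursion `S (k + 2) = X * S (k + 1) - S
k`; this is the link with the semicircle law. -/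
lemma wick_replicate (X : ι → A) (i : ι) : ∀ k : ℕ,
    wick X (List.replicate k i) = Polynomial.aeval (X i) (Polynomial.Chebyshev.S ℂ k)
  | 0 => by simp [wick_nil]
  | 1 => by simp [wick_singleton]
  | k + 2 => by
    have h1 := wick_replicate X i (k + 1)
    have h2 := wick_replicate X i k
    rw [List.replicate_succ, List.replicate_succ, wick_cons_cons, ← List.replicate_succ, h1, h2]
    push_cast
    rw [Polynomial.Chebyshev.S_add_two]
    simp

lemma wick_eq_prod_of_isChain (X : ι → A) : ∀ w : List ι, w.IsChain (· ≠ ·) →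
    wick X w = (w.map X).prod
  | [], _ => by simp [wick_nil]
  | [i], _ => by simp [wick_singleton]
  | i :: j :: w, h => by
    rw [List.isChain_cons_cons] at h
    rw [wick_cons_cons, wick_eq_prod_of_isChain X (j :: w) h.2]
    simp [h.1]

/-- Cutting a word into maximal constant blocks creates seams between different letters, where no
correction occurs. The word is thus an alternating product of centred Chebyshev blocks, the form to
which freeness applies. Equality of the heads keeps the product alternating; the induction is on a
length bound because each step removes a whole block. -/
lemma exists_alternating_wick (X : ι → A) (φ : A →ₗ[ℂ] ℂ) (B : ι → Subalgebra ℂ A)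
    (hXB : ∀ i, X i ∈ B i)
    (hφ : ∀ i (k : ℕ), 1 ≤ k → φ (Polynomial.aeval (X i) (Polynomial.Chebyshev.S ℂ k)) = 0)
    (n : ℕ) : ∀ w : List ι, w.length ≤ n →
      ∃ L : List (ι × A), (L.map Prod.snd).prod = wick X w ∧
        (L.map Prod.fst).head? = w.head? ∧ (L.IsChain fun x y => x.1 ≠ y.1) ∧
        ∀ x ∈ L, x.2 ∈ B x.1 ∧ φ x.2 = 0 := by
  induction n with
  | zero =>
    intro w hw
    obtain rfl : w = [] := by simpa using hw
    exact ⟨[], by simp [wick_nil]⟩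
  | succ n ih =>
    intro w hw
    rcases w with _ | ⟨i, w⟩
    · exact ⟨[], by simp [wick_nil]⟩
    set k := (w.takeWhile (· == i)).length with hk
    have htake : w.takeWhile (· == i) = List.replicate k i := by
      rw [List.eq_replicate_iff]
      refine ⟨hk.symm, fun b hb => ?_⟩
      simpa using List.mem_takeWhile_imp hb
    -- The first block is written with its last letter split off, the shape required by
    -- `wick_concat_mul_cons`.
    have hsplit : i :: w = List.replicate k i ++ [i] ++ w.dropWhile (· == i) := by
      conv_lhs => rw [← List.takeWhile_append_dropWhile (p := (· == i)) (l := w), htake]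
      rw [← List.replicate_succ', List.replicate_succ]
      rfl
    have hlen : (w.dropWhile (· == i)).length ≤ n := by
      have := (List.dropWhile_suffix (l := w) (· == i)).length_le
      simp only [List.length_cons] at hw
      omega
    have hhead : ∀ j, (w.dropWhile (· == i)).head? = some j → i ≠ j := by
      intro j hj hij
      have := List.head?_dropWhile_not (· == i) w
      rw [hj] at this
      simp [hij] at this
    obtain ⟨L, hL1, hL2, hL3, hL4⟩ := ih _ hlen
    have hmul : wick X (i :: w) =
        wick X (List.replicate k i ++ [i]) * wick X (w.dropWhile (· == i)) := by
      rw [hsplit]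
      generalize w.dropWhile (· == i) = d at *
      rcases d with _ | ⟨j, d⟩
      · simp [wick_nil]
      · have := hhead j rfl
        rw [wick_concat_mul_cons]
        simp [this]
    refine ⟨(i, wick X (List.replicate k i ++ [i])) :: L, ?_, by simp, ?_, ?_⟩
    · rw [hmul]; simp [hL1]
    · rw [List.isChain_cons]
      refine ⟨?_, hL3⟩
      intro y hy
      refine hhead _ ?_
      rw [← hL2]
      rw [List.head?_map]
      rw [Option.mem_def] at hy
      rw [hy]; rfl
    · intro x hx
      rcases List.mem_cons.1 hx with rfl | hx
      · rw [← List.replicate_succ', wick_replicate]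
        refine ⟨?_, hφ _ _ (by omega)⟩
        exact Algebra.adjoin_le (S := B i) (by simpa using hXB i)
          (Polynomial.aeval_mem_adjoin_singleton ℂ (X i))
      · exact hL4 x hx

/-- Wick words of free semicircular elements are centred. -/
lemma map_wick_eq_zero {X : ι → A} {φ : A →ₗ[ℂ] ℂ} {B : ι → Subalgebra ℂ A}
    (hfree : FreeSubalgebras φ B) (hXB : ∀ i, X i ∈ B i)
    (hφ : ∀ i (k : ℕ), 1 ≤ k → φ (Polynomial.aeval (X i) (Polynomial.Chebyshev.S ℂ k)) = 0)
    (w : List ι) (hw : w ≠ []) : φ (wick X w) = 0 := by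
  obtain ⟨L, hL1, hL2, hL3, hL4⟩ := exists_alternating_wick X φ B hXB hφ _ w le_rfl
  rw [← hL1]
  refine hfree.map_list_prod L ?_ hL3 hL4
  rintro rfl
  rcases w with _ | ⟨i, w⟩
  · exact hw rfl
  · simp at hL2

/-- Orthonormality of the Wick words. -/
lemma map_wick_reverse_mul_wick {X : ι → A} {φ : A →ₗ[ℂ] ℂ} (h1 : φ 1 = 1)
    (h0 : ∀ w : List ι, w ≠ [] → φ (wick X w) = 0) : ∀ u v : List ι,
    φ (wick X u.reverse * wick X v) = if u = v then 1 else 0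
  | [], [] => by simp [wick_nil, h1]
  | [], j :: v => by simp [wick_nil, h0]
  | i :: u, [] => by simp [wick_nil, h0]
  | i :: u, j :: v => by
    have ih := map_wick_reverse_mul_wick h1 h0 u v
    rw [List.reverse_cons, wick_concat_mul_cons, map_add, h0 _ (by simp)]
    by_cases hij : i = j <;> simp [hij, ih]

end WickWords

/-! ### Chebyshev polynomials and the semicircle law -/

section Semicircle

open Polynomial Polynomial.Chebyshev

/-- Since `(1 - x²) U_k = T_1 T_{k+1} - T_{k+2}`, the integral becomes one against the arcsine
weight `1 / √(1 - x²)`, and vanishes by orthogonality of the `T` polynomials; `k ≥ 1` separates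
`T_1` from `T_{k+1}`. -/
lemma integral_U_mul_sqrt (k : ℕ) (hk : 1 ≤ k) :
    ∫ x, (U ℝ k).eval x * √(1 - x ^ 2) = 0 := by
  have h1 : ∫ x, (U ℝ k).eval x * √(1 - x ^ 2) =
      ∫ x in (-1 : ℝ)..1, (U ℝ k).eval x * √(1 - x ^ 2) := by
    rw [intervalIntegral.integral_of_le (by norm_num)]
    refine (setIntegral_eq_integral_of_forall_compl_eq_zero fun x hx => ?_).symm
    rw [Real.sqrt_eq_zero_of_nonpos, mul_zero]
    by_contra! h
    have h2 := abs_lt.1 ((sq_lt_one_iff_abs_lt_one x).1 (by linarith))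
    exact hx ⟨h2.1, h2.2.le⟩
  have h2 : ∫ x in (-1 : ℝ)..1, (U ℝ k).eval x * √(1 - x ^ 2) =
      ∫ x, (T ℝ 1).eval x * (T ℝ ((k + 1 : ℕ) : ℤ)).eval x - (T ℝ (k + 2)).eval x
        ∂measureT := by
    rw [integral_measureT]
    refine intervalIntegral.integral_congr fun x hx => ?_
    have h3 := congr_arg (Polynomial.eval x) (one_sub_X_sq_mul_U_eq_pol_in_T ℝ k)
    simp only [eval_mul, eval_sub, eval_one, eval_pow, eval_X] at h3
    simp only [T_one, eval_X]
    push_cast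
    rw [← h3]
    rw [Set.uIcc_of_le (by norm_num)] at hx
    have h4 : 0 ≤ 1 - x ^ 2 := by nlinarith [hx.1, hx.2]
    rw [Real.sqrt_inv]
    -- At the endpoints both sides are zero, by the convention that the inverse of zero is zero.
    rcases h4.eq_or_lt with h4 | h4
    · simp [← h4]
    · have h5 := Real.sqrt_ne_zero'.2 h4
      field_simp
      rw [Real.sq_sqrt h4.le]
  rw [h1, h2, integral_sub (integrable_measureT (by fun_prop)) (integrable_measureT (by fun_prop)),
    integral_eval_T_real_measureT_of_ne_zero (by omega), sub_zero]
  exact_mod_cast integral_eval_T_real_mul_eval_T_real_measureT_of_ne (n := 1) (m := k + 1)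
    (by omega)

lemma integral_semicircular {v : ℝ} (hv : 0 < v) (g : ℝ → ℝ) :
    ∫ x, g x ∂(semicircular v) = ∫ x, 1 / (2 * Real.pi * v) * √(4 * v - x ^ 2) * g x := by
  rw [semicircular, integral_withDensity_eq_integral_toReal_smul (by fun_prop) (by simp)]
  refine integral_congr_ae (.of_forall fun x => ?_)
  have : 0 ≤ 1 / (2 * Real.pi * v) * √(4 * v - x ^ 2) := by positivity
  simp only [ENNReal.toReal_ofReal this, smul_eq_mul]

lemma integrable_semicircular {v : ℝ} (hv : 0 < v) {g : ℝ → ℝ} (hg : Continuous g) :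
    Integrable g (semicircular v) := by
  rw [semicircular, integrable_withDensity_iff_integrable_smul' (by fun_prop) (by simp)]
  have hcont : Continuous fun x => 1 / (2 * Real.pi * v) * √(4 * v - x ^ 2) * g x := by fun_prop
  have : Integrable fun x => 1 / (2 * Real.pi * v) * √(4 * v - x ^ 2) * g x := by
    refine hcont.integrable_of_hasCompactSupport
      (HasCompactSupport.of_support_subset_isCompact (isCompact_Icc (a := -√(4 * v))
        (b := √(4 * v))) fun x hx => ?_)
    rw [Set.mem_Icc, ← abs_le]
    by_contra! h
    refine hx ?_
    have : √(4 * v - x ^ 2) = 0 := by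
      apply Real.sqrt_eq_zero_of_nonpos
      have := Real.lt_sq_of_sqrt_lt h
      rw [sq_abs] at this
      linarith
    simp [this]
  refine this.congr (.of_forall fun x => ?_)
  have h0 : 0 ≤ 1 / (2 * Real.pi * v) * √(4 * v - x ^ 2) := by positivity
  simp only [ENNReal.toReal_ofReal h0, smul_eq_mul]

/-- The rescaled Chebyshev polynomials of the second kind are centred for the semicircle law. -/
lemma integral_S_semicircular {v : ℝ} (hv : 0 < v) (k : ℕ) (hk : 1 ≤ k) :
    ∫ x, (S ℝ k).eval ((√v)⁻¹ * x) ∂(semicircular v) = 0 := by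
  have hs : 0 < √v := Real.sqrt_pos.2 hv
  rw [integral_semicircular hv]
  set F : ℝ → ℝ := fun x =>
    1 / (2 * Real.pi * v) * √(4 * v - x ^ 2) * (S ℝ k).eval ((√v)⁻¹ * x) with hF
  -- The substitution `x = 2√v y` carries the density to a multiple of `√(1 - y²)` and `S_k(x / √v)`
  -- to `S_k(2y) = U_k(y)`.
  have h1 := Measure.integral_comp_mul_left F (2 * √v)
  have h2 : ∀ y, F (2 * √v * y) =
      1 / (2 * Real.pi * v) * (2 * √v) * ((U ℝ k).eval y * √(1 - y ^ 2)) := by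
    intro y
    simp only [hF]
    have h3 : 4 * v - (2 * √v * y) ^ 2 = (2 * √v) ^ 2 * (1 - y ^ 2) := by
      rw [mul_pow, mul_pow, Real.sq_sqrt hv.le]; ring
    have h4 : (√v)⁻¹ * (2 * √v * y) = 2 * y := by field_simp
    rw [h3, h4, Real.sqrt_mul (by positivity), Real.sqrt_sq (by positivity),
      ← S_comp_two_mul_X ℝ k, eval_comp]
    simp
    ring
  simp only [h2] at h1
  rw [integral_const_mul, integral_U_mul_sqrt k hk, mul_zero] at h1
  have h3 : |(2 * √v)⁻¹| ≠ 0 := by positivity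
  exact (smul_eq_zero.1 h1.symm).resolve_left h3

variable {A : Type*} [CStarAlgebra A]

lemma HasDistribution.map_aeval {φ : A →ₗ[ℂ] ℂ} {Y : A} {v : ℝ} (hv : 0 < v)
    (h : HasDistribution φ Y (semicircular v)) (p : ℝ[X]) :
    φ (aeval Y (p.map (algebraMap ℝ ℂ))) = ((∫ x, p.eval x ∂(semicircular v) : ℝ) : ℂ) := by
  induction p using Polynomial.induction_on' with
  | add p q hp hq =>
    simp only [Polynomial.map_add, map_add, hp, hq, eval_add]
    rw [integral_add (integrable_semicircular hv (by fun_prop))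
      (integrable_semicircular hv (by fun_prop))]
    push_cast; rfl
  | monomial n a =>
    simp only [map_monomial, aeval_monomial, eval_monomial]
    rw [integral_const_mul, ← Algebra.smul_def, map_smul, h n]
    simp

lemma HasDistribution.map_aeval_S {φ : A →ₗ[ℂ] ℂ} {Y : A} {v : ℝ} (hv : 0 < v)
    (h : HasDistribution φ Y (semicircular v)) (k : ℕ) (hk : 1 ≤ k) :
    φ (aeval ((((√v)⁻¹ : ℝ) : ℂ) • Y) (S ℂ k)) = 0 := by
  have h1 := h.map_aeval hv ((S ℝ k).comp (C (√v)⁻¹ * X))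
  have h2 : (fun x => ((S ℝ k).comp (C (√v)⁻¹ * X)).eval x) =
      fun x => (S ℝ k).eval ((√v)⁻¹ * x) := by
    ext x; simp [eval_comp]
  rw [h2, integral_S_semicircular hv k hk] at h1
  rw [Complex.ofReal_zero] at h1
  rw [← h1, Polynomial.map_comp, map_S, aeval_comp]
  simp [Algebra.smul_def]

end Semicircle

/-! ### Faithful traces -/

section Trace

variable {A : Type*} [CStarAlgebra A] {φ : A →ₗ[ℂ] ℂ}

lemma IsFaithfulTrace.re_nonneg (hφ : IsFaithfulTrace φ) (a : A) : 0 ≤ (φ (star a * a)).re :=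
  (Complex.nonneg_iff.1 (hφ.nonneg a)).1

lemma IsFaithfulTrace.ofReal_re (hφ : IsFaithfulTrace φ) (a : A) :
    (((φ (star a * a)).re : ℝ) : ℂ) = φ (star a * a) :=
  Complex.ext rfl (Complex.nonneg_iff.1 (hφ.nonneg a)).2

/-- Boundedness is not part of the hypotheses; it follows from positivity, read in the spectral
order. -/
lemma IsFaithfulTrace.continuous (hφ : IsFaithfulTrace φ) : Continuous φ := by
  let _ := CStarAlgebra.spectralOrder A
  have _ := CStarAlgebra.spectralOrderedRing A
  obtain ⟨C, hC⟩ := PositiveLinearMap.exists_norm_apply_le (PositiveLinearMap.mk₀ φ (by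
    intro x hx
    obtain ⟨b, rfl⟩ := CStarAlgebra.nonneg_iff_eq_star_mul_self.1 hx
    exact hφ.nonneg b))
  exact AddMonoidHomClass.continuous_of_bound φ C hC

/-- The Cauchy–Schwarz bound for a sum, obtained by adding the inequalities `φ(|b i - b j|²) ≥ 0`
over all pairs. -/
lemma IsFaithfulTrace.re_map_sum_le (hφ : IsFaithfulTrace φ) {κ : Type*} (s : Finset κ)
    (b : κ → A) :
    (φ (star (∑ i ∈ s, b i) * ∑ i ∈ s, b i)).re ≤
      s.card * ∑ i ∈ s, (φ (star (b i) * b i)).re := by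
  have h1 : (φ (star (∑ i ∈ s, b i) * ∑ i ∈ s, b i)).re =
      ∑ i ∈ s, ∑ j ∈ s, (φ (star (b i) * b j)).re := by
    simp [star_sum, Finset.sum_mul_sum]
  have h2 : ∑ i ∈ s, ∑ j ∈ s, (φ (star (b j) * b i)).re =
      ∑ i ∈ s, ∑ j ∈ s, (φ (star (b i) * b j)).re := Finset.sum_comm
  have h3 : ∀ i j, (φ (star (b i) * b j)).re + (φ (star (b j) * b i)).re ≤
      (φ (star (b i) * b i)).re + (φ (star (b j) * b j)).re := by
    intro i j
    have := hφ.re_nonneg (b i - b j)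
    simp only [star_sub, sub_mul, mul_sub, map_sub, Complex.sub_re] at this
    linarith
  have h4 : ∑ i ∈ s, ∑ j ∈ s, ((φ (star (b i) * b j)).re + (φ (star (b j) * b i)).re) ≤
      ∑ i ∈ s, ∑ j ∈ s, ((φ (star (b i) * b i)).re + (φ (star (b j) * b j)).re) :=
    Finset.sum_le_sum fun i _ => Finset.sum_le_sum fun j _ => h3 i j
  simp only [Finset.sum_add_distrib, Finset.sum_const, nsmul_eq_mul, ← Finset.mul_sum, h2] at h4
  rw [h1]
  linarith

/-- A faithful trace recovers the norm from the growth of the moments. -/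
lemma IsFaithfulTrace.norm_le_of_moments (hφ : IsFaithfulTrace φ) (T : A) {M : ℝ} (hM : 0 ≤ M)
    (h : ∀ k : ℕ, (φ ((star T * T) ^ k)).re ≤ M ^ k) : ‖star T * T‖ ≤ M := by
  let _ := CStarAlgebra.spectralOrder A
  have _ := CStarAlgebra.spectralOrderedRing A
  by_contra! hlt
  set a := star T * T with ha
  have ha0 : 0 ≤ a := star_mul_self_nonneg T
  have hsa : IsSelfAdjoint a := ha0.isSelfAdjoint
  have _ : Nontrivial A := ⟨a, 0, by rintro h0; rw [h0, norm_zero] at hlt; linarith⟩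
  obtain ⟨r, hMr, hr⟩ := exists_between hlt
  have hr0 : 0 < r := hM.trans_lt hMr
  -- With `M < r < ‖a‖`, this cutoff sees only the spectrum above `r`; `g a` is nonzero because
  -- `‖a‖` lies in the spectrum of `a`.
  set g : ℝ → ℝ := fun x => max (x - r) 0 with hg
  have hgc : Continuous g := by fun_prop
  set G : A := cfc g a with hG
  have hGsa : IsSelfAdjoint G := cfc_predicate g a
  have hG0 : G ≠ 0 := by
    intro h0
    have h1 : g ‖a‖ ∈ spectrum ℝ G := by
      rw [hG, cfc_map_spectrum g a hsa hgc.continuousOn]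
      exact ⟨_, CStarAlgebra.norm_mem_spectrum_of_nonneg ha0, rfl⟩
    rw [h0, spectrum.zero_eq] at h1
    have h2 : g ‖a‖ = 0 := h1
    have : 0 < g ‖a‖ := lt_max_of_lt_left (by linarith)
    linarith
  have hpos : 0 < (φ (star G * G)).re := by
    refine lt_of_le_of_ne (hφ.re_nonneg G) fun h0 => hG0 (hφ.faithful G ?_)
    rw [← hφ.ofReal_re, ← h0, Complex.ofReal_zero]
  set K : ℝ := ‖a‖ ^ 2 with hK
  have hK0 : 0 < K := by have : 0 < ‖a‖ := hr0.trans hr; positivity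
  -- On the spectrum `r ^ k * g² ≤ ‖a‖² * x ^ k`. Applying `φ` bounds `φ(G²)` by `K (M / r) ^ k`,
  -- which tends to zero and contradicts faithfulness.
  have key : ∀ k : ℕ, r ^ k * (φ (star G * G)).re ≤ K * M ^ k := by
    intro k
    have hmono : cfc (fun x => r ^ k * (g x * g x)) a ≤ cfc (fun x => K * x ^ k) a := by
      refine cfc_mono (fun x hx => ?_) (by fun_prop) (by fun_prop)
      have hx0 : 0 ≤ x := spectrum_nonneg_of_nonneg ha0 hx
      have hx1 : x ≤ ‖a‖ := (le_abs_self x).trans (spectrum.norm_le_norm_of_mem hx)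
      rcases le_or_gt x r with hxr | hxr
      · have : g x = 0 := max_eq_right (by linarith)
        rw [this]; simp; positivity
      · have h1 : g x = x - r := max_eq_left (by linarith)
        have h2 : g x * g x ≤ K := by rw [h1, hK]; nlinarith
        have h3 : r ^ k ≤ x ^ k := pow_le_pow_left₀ hr0.le hxr.le k
        calc r ^ k * (g x * g x) ≤ x ^ k * K :=
              mul_le_mul h3 h2 (mul_self_nonneg _) (by positivity)
          _ = _ := mul_comm _ _
    rw [cfc_const_mul _ _ _ (by fun_prop), cfc_const_mul _ _ _ (by fun_prop),
      cfc_mul _ _ _ (by fun_prop) (by fun_prop), cfc_pow_id a k] at hmono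
    obtain ⟨b, hb⟩ := CStarAlgebra.nonneg_iff_eq_star_mul_self.1 (sub_nonneg.2 hmono)
    have h1 := hφ.re_nonneg b
    rw [← hb, map_sub, ← hG, ← Complex.coe_smul, ← Complex.coe_smul, map_smul, map_smul] at h1
    simp only [Complex.sub_re, smul_eq_mul, Complex.re_ofReal_mul] at h1
    rw [hGsa.star_eq]
    have := mul_le_mul_of_nonneg_left (h k) hK0.le
    linarith
  have hlim : Tendsto (fun k : ℕ => K * (M / r) ^ k) atTop (𝓝 0) := by
    have := (tendsto_pow_atTop_nhds_zero_of_lt_one (r := M / r) (by positivity)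
      ((div_lt_one hr0).2 hMr)).const_mul K
    simpa using this
  have hle : (φ (star G * G)).re ≤ 0 := by
    refine ge_of_tendsto' hlim fun k => ?_
    have := key k
    rw [div_pow, ← mul_div_assoc, le_div_iff₀ (by positivity)]
    linarith
  linarith

end Trace

/-! ### Contractions as bounded bilinear maps -/

section Contraction

open scoped ENNReal

/-- Pointwise domination of a mixed integral by the square functions gives an `L²` bound. -/
lemma eLpNorm_mixed {α β γ : Type*} [MeasurableSpace α] [MeasurableSpace β]
    [MeasurableSpace γ] {μ : Measure α} {ν : Measure β} {ρ : Measure γ}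
    [SFinite μ] [SFinite ν] [SFinite ρ] {u : α × γ → ℂ} {v : γ × β → ℂ}
    (hu : StronglyMeasurable u) (hv : StronglyMeasurable v) :
    eLpNorm (fun z : α × β => ∫ s, u (z.1, s) * v (s, z.2) ∂ρ) 2 (μ.prod ν) ≤
      eLpNorm u 2 (μ.prod ρ) * eLpNorm v 2 (ρ.prod ν) ∧
    ∀ [Unique γ] [IsProbabilityMeasure ρ],
      eLpNorm (fun z : α × β => ∫ s, u (z.1, s) * v (s, z.2) ∂ρ) 2 (μ.prod ν) =
        eLpNorm u 2 (μ.prod ρ) * eLpNorm v 2 (ρ.prod ν) := by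
  have hum := hu.measurable
  have hvm := hv.measurable
  have hsum : ∫⁻ z : α × β, (∫⁻ s, ‖u (z.1, s)‖ₑ ^ (2 : ℝ) ∂ρ) *
      (∫⁻ s, ‖v (s, z.2)‖ₑ ^ (2 : ℝ) ∂ρ) ∂(μ.prod ν) =
      (∫⁻ z, ‖u z‖ₑ ^ (2 : ℝ) ∂(μ.prod ρ)) * ∫⁻ z, ‖v z‖ₑ ^ (2 : ℝ) ∂(ρ.prod ν) := by
    rw [lintegral_prod (fun z => ‖u z‖ₑ ^ (2 : ℝ)) (by fun_prop),
      lintegral_prod_symm (fun z => ‖v z‖ₑ ^ (2 : ℝ)) (by fun_prop),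
      ← lintegral_prod_mul (by fun_prop) (by fun_prop)]
  simp only [eLpNorm_eq_lintegral_rpow_enorm_toReal (p := 2) (by norm_num) (by norm_num),
    ENNReal.toReal_ofNat]
  rw [← ENNReal.mul_rpow_of_nonneg _ _ (by norm_num), ← hsum]
  refine ⟨ENNReal.rpow_le_rpow (lintegral_mono fun z => ?_) (by norm_num), ?_⟩
  · have h1 : ‖∫ s, u (z.1, s) * v (s, z.2) ∂ρ‖ₑ ≤
        (∫⁻ s, ‖u (z.1, s)‖ₑ ^ (2 : ℝ) ∂ρ) ^ (1 / 2 : ℝ) *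
          (∫⁻ s, ‖v (s, z.2)‖ₑ ^ (2 : ℝ) ∂ρ) ^ (1 / 2 : ℝ) := by
      refine (enorm_integral_le_lintegral_enorm _).trans ?_
      simp only [enorm_mul]
      exact ENNReal.lintegral_mul_le_Lp_mul_Lq ρ Real.HolderConjugate.two_two
        (by fun_prop) (by fun_prop)
    refine (ENNReal.rpow_le_rpow h1 (by norm_num)).trans (le_of_eq ?_)
    rw [ENNReal.mul_rpow_of_nonneg _ _ (by norm_num), ← ENNReal.rpow_mul, ← ENNReal.rpow_mul]
    norm_num
  -- Over a one-point probability space the integral is a plain product, so Cauchy–Schwarz is an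
  -- equality; this is the case `p = 0`.
  · intro _ _
    congr 1
    refine lintegral_congr fun z => ?_
    simp [integral_unique, lintegral_unique, enorm_mul, mul_pow]

variable {n m p : ℕ}

/-- Contractions are computed from representatives, so null sets of the kernels must be seen to be
null after gluing, for almost all free variables. -/
lemma ae_glue_left (hn : p ≤ n) {P : (Fin n → ℝ) → Prop} (h : ∀ᵐ x ∂(orthant n), P x) :
    ∀ᵐ t ∂(orthant ((n - p) + (m - p))), ∀ᵐ s ∂(orthant p),
      P (glue (Nat.sub_add_cancel hn) (fun i => t (Fin.castAdd (m - p) i)) s) := by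
  have h1 := (measurePreserving_glue (Nat.sub_add_cancel hn)).quasiMeasurePreserving.ae h
  have h2 := Measure.ae_ae_of_ae_prod h1
  exact (Measure.quasiMeasurePreserving_fst.comp
    (measurePreserving_split (n - p) (m - p)).quasiMeasurePreserving).ae h2

lemma measurePreserving_glue_reverse (hm : p ≤ m) :
    MeasurePreserving (fun z : (Fin p → ℝ) × (Fin (m - p) → ℝ) =>
      glue (Nat.add_sub_cancel' hm) (reverse z.1) z.2)
      ((orthant p).prod (orthant (m - p))) (orthant m) :=
  (measurePreserving_glue (Nat.add_sub_cancel' hm)).comp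
    ((measurePreserving_reverse p).prod (MeasurePreserving.id _))

/-- The free variables are put first, the order in which Fubini yields sections in the integrated
variables. -/
lemma measurePreserving_glue_reverse_swap (hm : p ≤ m) :
    MeasurePreserving (fun z : (Fin (m - p) → ℝ) × (Fin p → ℝ) =>
      glue (Nat.add_sub_cancel' hm) (reverse z.2) z.1)
      ((orthant (m - p)).prod (orthant p)) (orthant m) :=
  (measurePreserving_glue_reverse hm).comp Measure.measurePreserving_swap

lemma ae_glue_right (hm : p ≤ m) {P : (Fin m → ℝ) → Prop} (h : ∀ᵐ x ∂(orthant m), P x) :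
    ∀ᵐ t ∂(orthant ((n - p) + (m - p))), ∀ᵐ s ∂(orthant p),
      P (glue (Nat.add_sub_cancel' hm) (reverse s) (fun j => t (Fin.natAdd (n - p) j))) := by
  have h1 := (measurePreserving_glue_reverse_swap hm).quasiMeasurePreserving.ae h
  have h2 := Measure.ae_ae_of_ae_prod h1
  exact (Measure.quasiMeasurePreserving_snd.comp
    (measurePreserving_split (n - p) (m - p)).quasiMeasurePreserving).ae h2

lemma nestedIntegral_congr_ae (hn : p ≤ n) (hm : p ≤ m) {f F : (Fin n → ℝ) → ℂ}
    {g G : (Fin m → ℝ) → ℂ} (hf : f =ᵐ[orthant n] F) (hg : g =ᵐ[orthant m] G) :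
    nestedIntegral hn hm f g =ᵐ[orthant ((n - p) + (m - p))] nestedIntegral hn hm F G := by
  filter_upwards [ae_glue_left (m := m) hn hf, ae_glue_right (n := n) hm hg] with t h1 h2
  refine integral_congr_ae ?_
  filter_upwards [h1, h2] with s h3 h4
  rw [h3, h4]

lemma ae_memLp_section {α γ : Type*} [MeasurableSpace α] [MeasurableSpace γ] {μ : Measure α}
    {ρ : Measure γ} [SFinite μ] [SFinite ρ] {u : α × γ → ℂ} (hu : MemLp u 2 (μ.prod ρ)) :
    ∀ᵐ x ∂μ, MemLp (fun s => u (x, s)) 2 ρ := by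
  have h1 := (memLp_two_iff_integrable_sq_norm hu.1).1 hu
  filter_upwards [h1.prod_right_ae, hu.1.prodMk_left] with x h2 h3
  exact (memLp_two_iff_integrable_sq_norm h3).2 h2

/-- Almost every section of a square integrable kernel is square integrable, and a product of two
such sections is integrable. Additivity of the contraction rests on this. -/
lemma ae_integrable_nested (hn : p ≤ n) (hm : p ≤ m) (f : L2 n) (g : L2 m) :
    ∀ᵐ t ∂(orthant ((n - p) + (m - p))), Integrable (fun s =>
      f (glue (Nat.sub_add_cancel hn) (fun i => t (Fin.castAdd (m - p) i)) s) *
      g (glue (Nat.add_sub_cancel' hm) (reverse s) (fun j => t (Fin.natAdd (n - p) j))))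
      (orthant p) := by
  have h1 := ae_memLp_section ((Lp.memLp f).comp_measurePreserving
    (measurePreserving_glue (Nat.sub_add_cancel hn)))
  have h2 := ae_memLp_section ((Lp.memLp g).comp_measurePreserving
    (measurePreserving_glue_reverse_swap hm))
  have h3 := (Measure.quasiMeasurePreserving_fst.comp
    (measurePreserving_split (n - p) (m - p)).quasiMeasurePreserving).ae h1
  have h4 := (Measure.quasiMeasurePreserving_snd.comp
    (measurePreserving_split (n - p) (m - p)).quasiMeasurePreserving).ae h2
  filter_upwards [h3, h4] with t h5 h6
  exact MemLp.integrable_mul h5 h6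

lemma contraction_coeFn (hn : p ≤ n) (hm : p ≤ m) (f : L2 n) (g : L2 m) :
    contraction p f g =ᵐ[orthant ((n - p) + (m - p))] nestedIntegral hn hm f g := by
  rw [contraction, dif_pos ⟨hn, hm⟩]
  exact MemLp.coeFn_toLp _

lemma contraction_of_lt (h : ¬ (p ≤ n ∧ p ≤ m)) (f : L2 n) (g : L2 m) :
    contraction p f g = 0 := by
  rw [contraction, dif_neg h]

lemma contraction_add_left (f f' : L2 n) (g : L2 m) :
    contraction p (f + f') g = contraction p f g + contraction p f' g := by
  by_cases h : p ≤ n ∧ p ≤ m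
  swap
  · simp [contraction_of_lt h]
  obtain ⟨hn, hm⟩ := h
  apply Lp.ext
  filter_upwards [contraction_coeFn hn hm (f + f') g, contraction_coeFn hn hm f g,
    contraction_coeFn hn hm f' g, Lp.coeFn_add (contraction p f g) (contraction p f' g),
    ae_glue_left (m := m) hn (Lp.coeFn_add f f'), ae_integrable_nested hn hm f g,
    ae_integrable_nested hn hm f' g] with t h1 h2 h3 h4 h5 h6 h7
  rw [h1, h4, Pi.add_apply, h2, h3, nestedIntegral, nestedIntegral, nestedIntegral,
    ← integral_add h6 h7]
  refine integral_congr_ae ?_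
  filter_upwards [h5] with s h8
  rw [h8, Pi.add_apply, add_mul]

lemma contraction_add_right (f : L2 n) (g g' : L2 m) :
    contraction p f (g + g') = contraction p f g + contraction p f g' := by
  by_cases h : p ≤ n ∧ p ≤ m
  swap
  · simp [contraction_of_lt h]
  obtain ⟨hn, hm⟩ := h
  apply Lp.ext
  filter_upwards [contraction_coeFn hn hm f (g + g'), contraction_coeFn hn hm f g,
    contraction_coeFn hn hm f g', Lp.coeFn_add (contraction p f g) (contraction p f g'),
    ae_glue_right (n := n) hm (Lp.coeFn_add g g'), ae_integrable_nested hn hm f g,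
    ae_integrable_nested hn hm f g'] with t h1 h2 h3 h4 h5 h6 h7
  rw [h1, h4, Pi.add_apply, h2, h3, nestedIntegral, nestedIntegral, nestedIntegral,
    ← integral_add h6 h7]
  refine integral_congr_ae ?_
  filter_upwards [h5] with s h8
  rw [h8, Pi.add_apply, mul_add]

lemma contraction_smul_left (c : ℂ) (f : L2 n) (g : L2 m) :
    contraction p (c • f) g = c • contraction p f g := by
  by_cases h : p ≤ n ∧ p ≤ m
  swap
  · simp [contraction_of_lt h]
  obtain ⟨hn, hm⟩ := h
  apply Lp.ext
  filter_upwards [contraction_coeFn hn hm (c • f) g, contraction_coeFn hn hm f g,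
    Lp.coeFn_smul c (contraction p f g),
    ae_glue_left (m := m) hn (Lp.coeFn_smul c f)] with t h1 h2 h4 h5
  rw [h1, h4, Pi.smul_apply, h2, nestedIntegral, nestedIntegral, ← integral_smul]
  refine integral_congr_ae ?_
  filter_upwards [h5] with s h8
  rw [h8, Pi.smul_apply, smul_mul_assoc]

lemma contraction_smul_right (c : ℂ) (f : L2 n) (g : L2 m) :
    contraction p f (c • g) = c • contraction p f g := by
  by_cases h : p ≤ n ∧ p ≤ m
  swap
  · simp [contraction_of_lt h]
  obtain ⟨hn, hm⟩ := h
  apply Lp.ext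
  filter_upwards [contraction_coeFn hn hm f (c • g), contraction_coeFn hn hm f g,
    Lp.coeFn_smul c (contraction p f g),
    ae_glue_right (n := n) hm (Lp.coeFn_smul c g)] with t h1 h2 h4 h5
  rw [h1, h4, Pi.smul_apply, h2, nestedIntegral, nestedIntegral, ← integral_smul]
  refine integral_congr_ae ?_
  filter_upwards [h5] with s h8
  rw [h8, Pi.smul_apply, mul_smul_comm]

/-- Cauchy–Schwarz in the integrated variables followed by Fubini in the free ones. The equality at
`p = 0` later supplies one of the two terms `‖f‖⁴`. -/
lemma eLpNorm_contraction (hn : p ≤ n) (hm : p ≤ m) (f : L2 n) (g : L2 m) :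
    ‖contraction p f g‖ ≤ ‖f‖ * ‖g‖ ∧ (p = 0 → ‖contraction p f g‖ = ‖f‖ * ‖g‖) := by
  have h1 := measurePreserving_glue (Nat.sub_add_cancel hn)
  have h2 := measurePreserving_glue_reverse hm
  have h3 := eLpNorm_mixed (μ := orthant (n - p)) (ν := orthant (m - p)) (ρ := orthant p)
    ((Lp.stronglyMeasurable f).comp_measurable h1.measurable)
    ((Lp.stronglyMeasurable g).comp_measurable h2.measurable)
  rw [eLpNorm_comp_measurePreserving (Lp.aestronglyMeasurable f) h1,
    eLpNorm_comp_measurePreserving (Lp.aestronglyMeasurable g) h2] at h3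
  have h4 : eLpNorm (contraction p f g) 2 (orthant ((n - p) + (m - p))) = eLpNorm
      (fun z : (Fin (n - p) → ℝ) × (Fin (m - p) → ℝ) => ∫ s,
        (f ∘ fun z : (Fin (n - p) → ℝ) × (Fin p → ℝ) => glue (Nat.sub_add_cancel hn) z.1 z.2)
          (z.1, s) *
        (g ∘ fun z : (Fin p → ℝ) × (Fin (m - p) → ℝ) =>
          glue (Nat.add_sub_cancel' hm) (reverse z.1) z.2) (s, z.2) ∂(orthant p)) 2
      ((orthant (n - p)).prod (orthant (m - p))) := by
    rw [eLpNorm_congr_ae (contraction_coeFn hn hm f g),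
      ← (measurePreserving_split (n - p) (m - p)).map_eq, eLpNorm_map_measure]
    · rfl
    · rw [(measurePreserving_split (n - p) (m - p)).map_eq]
      exact (memLp_integral_mul ((Lp.stronglyMeasurable f).comp_measurable h1.measurable)
        ((Lp.stronglyMeasurable g).comp_measurable h2.measurable)
        ((Lp.memLp f).comp_measurePreserving h1) ((Lp.memLp g).comp_measurePreserving h2)).1
    · exact (measurePreserving_split (n - p) (m - p)).measurable.aemeasurable
  rw [← h4] at h3
  simp only [Lp.norm_def, ← ENNReal.toReal_mul]
  refine ⟨ENNReal.toReal_mono (ENNReal.mul_ne_top (Lp.eLpNorm_ne_top f) (Lp.eLpNorm_ne_top g))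
    h3.1, ?_⟩
  rintro rfl
  have h5 : IsProbabilityMeasure (orthant 0) := ⟨by simp [orthant]⟩
  rw [h3.2]

lemma norm_contraction_le (p : ℕ) (f : L2 n) (g : L2 m) :
    ‖contraction p f g‖ ≤ ‖f‖ * ‖g‖ := by
  by_cases h : p ≤ n ∧ p ≤ m
  · exact (eLpNorm_contraction h.1 h.2 f g).1
  · rw [contraction_of_lt h, norm_zero]; positivity

lemma norm_contraction_zero (f : L2 n) (g : L2 m) : ‖contraction 0 f g‖ = ‖f‖ * ‖g‖ :=
  (eLpNorm_contraction (Nat.zero_le _) (Nat.zero_le _) f g).2 rfl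

/-- Contraction as a bounded bilinear map. -/
noncomputable def contractionL (n m p : ℕ) : L2 n →L[ℂ] L2 m →L[ℂ] L2 ((n - p) + (m - p)) :=
  LinearMap.mkContinuous₂ (LinearMap.mk₂ ℂ (contraction p) contraction_add_left
    contraction_smul_left contraction_add_right contraction_smul_right) 1
    fun f g => by simpa using norm_contraction_le p f g

lemma contractionL_apply (f : L2 n) (g : L2 m) : contractionL n m p f g = contraction p f g :=
  rfl

end Contraction

/-! ### The adjoint kernel -/

section Adjoint

variable {n : ℕ}

lemma adjoint_coeFn (f : L2 n) :
    adjoint f =ᵐ[orthant n] fun t => star (f (reverse t)) := by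
  filter_upwards [Lp.coeFn_star (Lp.compMeasurePreserving reverse (measurePreserving_reverse n) f),
    Lp.coeFn_compMeasurePreserving f (measurePreserving_reverse n)] with t h1 h2
  rw [adjoint, h1, Pi.star_apply, h2, Function.comp_apply]

lemma adjoint_add (f g : L2 n) : adjoint (f + g) = adjoint f + adjoint g := by
  apply Lp.ext
  filter_upwards [adjoint_coeFn (f + g), adjoint_coeFn f, adjoint_coeFn g,
    Lp.coeFn_add (adjoint f) (adjoint g),
    (measurePreserving_reverse n).quasiMeasurePreserving.ae (Lp.coeFn_add f g)] with t h1 h2 h3 h4 h5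
  rw [h1, h4, Pi.add_apply, h2, h3, h5, Pi.add_apply, star_add]

lemma adjoint_smul (c : ℂ) (f : L2 n) : adjoint (c • f) = star c • adjoint f := by
  apply Lp.ext
  filter_upwards [adjoint_coeFn (c • f), adjoint_coeFn f, Lp.coeFn_smul (star c) (adjoint f),
    (measurePreserving_reverse n).quasiMeasurePreserving.ae (Lp.coeFn_smul c f)] with t h1 h2 h3 h4
  rw [h1, h3, Pi.smul_apply, h2, h4, Pi.smul_apply, star_smul]

lemma norm_adjoint (f : L2 n) : ‖adjoint f‖ = ‖f‖ := by
  rw [adjoint, ← Lp.norm_compMeasurePreserving f (measurePreserving_reverse n), Lp.norm_def,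
    Lp.norm_def, eLpNorm_congr_ae (Lp.coeFn_star _)]
  congr 1
  exact eLpNorm_congr_norm_ae (.of_forall fun t => by simp)

lemma continuous_adjoint : Continuous (adjoint (n := n)) := by
  have h : ∀ f g : L2 n, adjoint (f - g) = adjoint f - adjoint g := fun f g => by
    have := adjoint_add (f - g) g
    rw [sub_add_cancel] at this
    rw [this, add_sub_cancel_right]
  refine (LipschitzWith.of_dist_le_mul (K := 1) fun f g => ?_).continuous
  rw [dist_eq_norm, dist_eq_norm, ← h, norm_adjoint]
  simp

end Adjoint

/-! ### Elementary tensors of an orthonormal system -/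

section Tensor

/-- A real orthonormal system in `L²(ℝ₊)`. -/
structure IsOrthonormalSystem {ι : Type*} [DecidableEq ι] (χ : ι → ℝ → ℝ) : Prop where
  measurable : ∀ i, Measurable (χ i)
  memLp : ∀ i, MemLp (χ i) 2 halfLine
  integral : ∀ i j, ∫ x, χ i x * χ j x ∂halfLine = if i = j then 1 else 0

variable {ι : Type*} [DecidableEq ι] {χ : ι → ℝ → ℝ}

/-- The function `χ_{w₁} ⊗ ⋯ ⊗ χ_{wₙ}`. -/
noncomputable def tensorFun (χ : ι → ℝ → ℝ) {n : ℕ} (w : Fin n → ι) (x : Fin n → ℝ) : ℂ :=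
  ∏ i, (χ (w i) (x i) : ℂ)

lemma memLp_tensorFun (hχ : IsOrthonormalSystem χ) {n : ℕ} (w : Fin n → ι) :
    MemLp (tensorFun χ w) 2 (orthant n) := by
  have hm : Measurable (tensorFun χ w) := by
    have := hχ.measurable
    unfold tensorFun
    fun_prop
  rw [memLp_two_iff_integrable_sq_norm hm.aestronglyMeasurable]
  have h := Integrable.fintype_prod (μ := fun _ : Fin n => halfLine)
    (f := fun i x => ‖χ (w i) x‖ ^ 2)
    fun i => (memLp_two_iff_integrable_sq_norm (hχ.memLp _).1).1 (hχ.memLp (w i))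
  convert h using 2 with x
  simp [tensorFun, Finset.prod_pow, sq_abs, ← Finset.abs_prod]

/-- `χ_{w₁} ⊗ ⋯ ⊗ χ_{wₙ}` as an element of `L²(ℝ₊ⁿ)`. -/
noncomputable def tensor (hχ : IsOrthonormalSystem χ) {n : ℕ} (w : Fin n → ι) : L2 n :=
  (memLp_tensorFun hχ w).toLp _

lemma tensor_coeFn (hχ : IsOrthonormalSystem χ) {n : ℕ} (w : Fin n → ι) :
    tensor hχ w =ᵐ[orthant n] tensorFun χ w := MemLp.coeFn_toLp _

lemma integral_tensorFun_mul (hχ : IsOrthonormalSystem χ) {n : ℕ} (w u : Fin n → ι) :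
    ∫ x, tensorFun χ w x * tensorFun χ u x ∂(orthant n) = if w = u then 1 else 0 := by
  simp only [tensorFun, ← Finset.prod_mul_distrib]
  rw [orthant, integral_fintype_prod_eq_prod (μ := fun _ => halfLine)
    (fun i x => (χ (w i) x : ℂ) * (χ (u i) x : ℂ))]
  have h : ∀ i, ∫ x, (χ (w i) x : ℂ) * (χ (u i) x : ℂ) ∂halfLine =
      if w i = u i then 1 else 0 := by
    intro i
    have := hχ.integral (w i) (u i)
    simp only [← Complex.ofReal_mul]
    rw [integral_complex_ofReal, this]
    split_ifs <;> simp
  simp only [h]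
  rw [Finset.prod_ite_zero]
  simp [funext_iff]

lemma inner_tensor (hχ : IsOrthonormalSystem χ) {n : ℕ} (w u : Fin n → ι) :
    inner ℂ (tensor hχ w) (tensor hχ u) = if w = u then 1 else 0 := by
  rw [L2.inner_def, ← integral_tensorFun_mul hχ w u]
  refine integral_congr_ae ?_
  filter_upwards [tensor_coeFn hχ w, tensor_coeFn hχ u] with x h1 h2
  rw [h1, h2, RCLike.inner_apply']
  congr 1
  simp [tensorFun]

lemma orthonormal_tensor (hχ : IsOrthonormalSystem χ) (n : ℕ) :
    Orthonormal ℂ (tensor hχ : (Fin n → ι) → L2 n) := by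
  rw [orthonormal_iff_ite]
  exact inner_tensor hχ

lemma adjoint_tensor (hχ : IsOrthonormalSystem χ) {n : ℕ} (w : Fin n → ι) :
    adjoint (tensor hχ w) = tensor hχ fun i => w i.rev := by
  apply Lp.ext
  filter_upwards [adjoint_coeFn (tensor hχ w), tensor_coeFn hχ fun i => w i.rev,
    (measurePreserving_reverse n).quasiMeasurePreserving.ae (tensor_coeFn hχ w)] with t h1 h2 h3
  rw [h1, h2, h3]
  simp only [tensorFun, reverse, star_prod, Complex.star_def, Complex.conj_ofReal]
  exact (Equiv.prod_comp Fin.revPerm fun i => (χ (w i) (t i.rev) : ℂ)).symm.trans (by simp)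

lemma prod_glue {a b n : ℕ} (h : a + b = n) (F : Fin n → ℝ → ℂ) (x : Fin a → ℝ)
    (y : Fin b → ℝ) :
    ∏ i, F i (glue h x y i) = (∏ i, F (Fin.cast h (Fin.castAdd b i)) (x i)) *
      ∏ j, F (Fin.cast h (Fin.natAdd a j)) (y j) := by
  subst h
  rw [Fin.prod_univ_add]
  simp [glue]

/-- The word of the free variables in the `p`-th contraction of two words. -/
def contractWord {n m p : ℕ} (hn : p ≤ n) (hm : p ≤ m) (w : Fin n → ι) (u : Fin m → ι) :
    Fin ((n - p) + (m - p)) → ι :=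
  Fin.append (fun i => w (Fin.cast (Nat.sub_add_cancel hn) (Fin.castAdd p i)))
    (fun j => u (Fin.cast (Nat.add_sub_cancel' hm) (Fin.natAdd p j)))

/-- The integrated variables carry the last `p` letters of `w` against the first `p` letters of `u`
in reverse order; orthonormality turns their integral into a Kronecker delta. -/
lemma nestedIntegral_tensorFun (hχ : IsOrthonormalSystem χ) {n m p : ℕ} (hn : p ≤ n)
    (hm : p ≤ m) (w : Fin n → ι) (u : Fin m → ι) :
    nestedIntegral hn hm (tensorFun χ w) (tensorFun χ u) = fun t =>
      (if (fun k => w (Fin.cast (Nat.sub_add_cancel hn) (Fin.natAdd (n - p) k))) =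
        (fun k => u (Fin.cast (Nat.add_sub_cancel' hm) (Fin.castAdd (m - p) k.rev)))
        then 1 else 0) * tensorFun χ (contractWord hn hm w u) t := by
  ext t
  rw [← integral_tensorFun_mul hχ, nestedIntegral, ← integral_mul_const]
  congr 1
  ext s
  simp only [tensorFun]
  rw [prod_glue _ (fun i x => (χ (w i) x : ℂ)), prod_glue _ (fun i x => (χ (u i) x : ℂ)),
    Fin.prod_univ_add]
  have h := Equiv.prod_comp Fin.revPerm fun k : Fin p =>
    (χ (u (Fin.cast (Nat.add_sub_cancel' hm) (Fin.castAdd (m - p) k))) (reverse s k) : ℂ)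
  rw [← h]
  simp only [contractWord, Fin.append_left, Fin.append_right, Fin.revPerm_apply, reverse,
    Fin.rev_rev]
  ring

lemma contraction_tensor (hχ : IsOrthonormalSystem χ) {n m p : ℕ} (hn : p ≤ n)
    (hm : p ≤ m) (w : Fin n → ι) (u : Fin m → ι) :
    contraction p (tensor hχ w) (tensor hχ u) =
      if (fun k => w (Fin.cast (Nat.sub_add_cancel hn) (Fin.natAdd (n - p) k))) =
        (fun k => u (Fin.cast (Nat.add_sub_cancel' hm) (Fin.castAdd (m - p) k.rev)))
        then tensor hχ (contractWord hn hm w u) else 0 := by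
  apply Lp.ext
  refine (contraction_coeFn hn hm _ _).trans ?_
  refine (nestedIntegral_congr_ae hn hm (tensor_coeFn hχ w) (tensor_coeFn hχ u)).trans ?_
  rw [nestedIntegral_tensorFun hχ]
  split_ifs
  · simpa using (tensor_coeFn hχ _).symm
  · simp only [zero_mul]
    exact (Lp.coeFn_zero ℂ 2 (orthant ((n - p) + (m - p)))).symm

end Tensor

/-! ### Chaos maps -/

section Chaos

/-- Together with `take_eq_take_iff`, this translates the contraction of tensors into the list form
of `wick_reverse_mul_wick`. -/
lemma ofFn_contractWord {ι : Type*} {n m p : ℕ} (hn : p ≤ n) (hm : p ≤ m) (w : Fin n → ι) (u : Fin m → ι) :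
    List.ofFn (contractWord hn hm w u) =
      ((List.ofFn w).reverse.drop p).reverse ++ (List.ofFn u).drop p := by
  rw [contractWord, List.ofFn_fin_append]
  congr 1
  · apply List.ext_getElem
    · simp
    · intro i h1 h2
      simp [List.drop_reverse]
  · apply List.ext_getElem
    · simp
    · intro i h1 h2
      simp

lemma take_eq_take_iff {ι : Type*} {n m p : ℕ} (hn : p ≤ n) (hm : p ≤ m) (w : Fin n → ι) (u : Fin m → ι) :
    (List.ofFn w).reverse.take p = (List.ofFn u).take p ↔
      (fun k => w (Fin.cast (Nat.sub_add_cancel hn) (Fin.natAdd (n - p) k))) =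
        (fun k => u (Fin.cast (Nat.add_sub_cancel' hm) (Fin.castAdd (m - p) k.rev))) := by
  rw [funext_iff]
  constructor
  · intro h k
    have h1 : ((List.ofFn w).reverse.take p)[(k.rev : ℕ)]'(by
        have := k.rev.2; simp; omega) =
        ((List.ofFn u).take p)[(k.rev : ℕ)]'(by have := k.rev.2; simp; omega) := by
      simp only [h]
    simp only [List.getElem_take, List.getElem_reverse, List.getElem_ofFn, List.length_ofFn] at h1
    convert h1 using 2
    · ext
      have := k.2
      simp [Fin.val_rev]
      omega
    · rfl
  · intro h
    apply List.ext_getElem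
    · simp; omega
    · intro i h1 h2
      have h3 : i < p := by simp at h1; omega
      have h4 := h (Fin.rev ⟨i, h3⟩)
      simp only [List.getElem_take, List.getElem_reverse, List.getElem_ofFn, List.length_ofFn]
      rw [Fin.rev_rev] at h4
      convert h4 using 2
      · ext
        simp [Fin.val_rev]
        omega
      · rfl

variable {A ι : Type*} [CStarAlgebra A] [DecidableEq ι] {χ : ι → ℝ → ℝ}

/-- The span of the elementary tensors of degree `n`. -/
noncomputable def tensorSpan (hχ : IsOrthonormalSystem χ) (n : ℕ) : Submodule ℂ (L2 n) :=
  Submodule.span ℂ (Set.range (tensor hχ : (Fin n → ι) → L2 n))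

/-- A system of centred self-adjoint variables: all Wick words of positive length are centred. -/
structure IsWickCentred (φ : A →ₗ[ℂ] ℂ) (X : ι → A) : Prop where
  selfAdjoint : ∀ i, IsSelfAdjoint (X i)
  map_wick : ∀ w : List ι, w ≠ [] → φ (wick X w) = 0

lemma IsWickCentred.map_star_wick_mul_wick {φ : A →ₗ[ℂ] ℂ} {X : ι → A}
    (hφ : IsFaithfulTrace φ) (hX : IsWickCentred φ X)
    (u v : List ι) : φ (star (wick X u) * wick X v) = if u = v then 1 else 0 := by
  rw [star_wick hX.selfAdjoint, map_wick_reverse_mul_wick hφ.map_one hX.map_wick]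

variable (hχ : IsOrthonormalSystem χ)

lemma contraction_mem_tensorSpan {n m : ℕ} (p : ℕ) {f : L2 n} {g : L2 m}
    (hf : f ∈ tensorSpan hχ n) (hg : g ∈ tensorSpan hχ m) :
    contraction p f g ∈ tensorSpan hχ ((n - p) + (m - p)) := by
  induction hf, hg using Submodule.span_induction₂ with
  | mem_mem x y hx hy =>
    obtain ⟨w, rfl⟩ := hx
    obtain ⟨u, rfl⟩ := hy
    by_cases h : p ≤ n ∧ p ≤ m
    · rw [contraction_tensor hχ h.1 h.2]
      split_ifs
      · exact Submodule.subset_span ⟨_, rfl⟩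
      · exact zero_mem _
    · rw [contraction_of_lt h]
      exact zero_mem _
  | zero_left y hy =>
    rw [← contractionL_apply, map_zero]
    exact zero_mem _
  | zero_right x hx =>
    rw [← contractionL_apply, map_zero]
    exact zero_mem _
  | add_left x y z _ _ _ hx hy =>
    rw [contraction_add_left]
    exact add_mem hx hy
  | add_right x y z _ _ _ hx hy =>
    rw [contraction_add_right]
    exact add_mem hx hy
  | smul_left c x y _ _ h =>
    rw [contraction_smul_left]
    exact Submodule.smul_mem _ _ h
  | smul_right c x y _ _ h =>
    rw [contraction_smul_right]
    exact Submodule.smul_mem _ _ h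

lemma adjoint_mem_tensorSpan {n : ℕ} {f : L2 n} (hf : f ∈ tensorSpan hχ n) :
    adjoint f ∈ tensorSpan hχ n := by
  induction hf using Submodule.span_induction with
  | mem x hx =>
    obtain ⟨w, rfl⟩ := hx
    rw [adjoint_tensor]
    exact Submodule.subset_span ⟨_, rfl⟩
  | zero =>
    rw [← zero_smul ℂ (0 : L2 n), adjoint_smul, star_zero, zero_smul]
    exact zero_mem _
  | add x y _ _ hx hy =>
    rw [adjoint_add]
    exact add_mem hx hy
  | smul c x _ h =>
    rw [adjoint_smul]
    exact Submodule.smul_mem _ _ h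

variable [Fintype ι]

/-- The map sending `χ_{w₁} ⊗ ⋯ ⊗ χ_{wₙ}` to the Wick word of `w`. -/
noncomputable def chaos (X : ι → A) (n : ℕ) : L2 n →L[ℂ] A :=
  ∑ w : Fin n → ι, (innerSL ℂ (tensor hχ w)).smulRight (wick X (List.ofFn w))

variable (X : ι → A)

/-- The map is defined on all of `L²` and kills the orthogonal complement of `tensorSpan`;
multiplicative and isometric identities are therefore stated for kernels in `tensorSpan`. -/
lemma chaos_apply {n : ℕ} (f : L2 n) :
    chaos hχ X n f = ∑ w : Fin n → ι, inner ℂ (tensor hχ w) f • wick X (List.ofFn w) := by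
  simp [chaos]

lemma chaos_tensor {n : ℕ} (w : Fin n → ι) :
    chaos hχ X n (tensor hχ w) = wick X (List.ofFn w) := by
  simp [chaos_apply, inner_tensor]

lemma chaos_mul_chaos_tensor {n m : ℕ} (w : Fin n → ι) (u : Fin m → ι) :
    chaos hχ X n (tensor hχ w) * chaos hχ X m (tensor hχ u) =
      ∑ p ∈ Finset.range (n + 1),
        chaos hχ X ((n - p) + (m - p)) (contraction p (tensor hχ w) (tensor hχ u)) := by
  have h := wick_reverse_mul_wick X (List.ofFn w).reverse (List.ofFn u)
  rw [List.reverse_reverse] at h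
  rw [chaos_tensor, chaos_tensor, h]
  simp only [List.length_reverse, List.length_ofFn]
  -- The product formula stops at `min n m`. The range is extended to `n`, independently of `m`,
  -- since `contraction` is zero for `p > m`.
  rw [← Finset.sum_subset (Finset.range_mono (Nat.succ_le_succ (min_le_left n m)))]
  · refine Finset.sum_congr rfl fun p hp => ?_
    rw [Finset.mem_range] at hp
    have hn : p ≤ n := by omega
    have hm : p ≤ m := by omega
    rw [contraction_tensor hχ hn hm]
    simp only [take_eq_take_iff hn hm]
    split_ifs
    · rw [chaos_tensor, ofFn_contractWord]
    · rw [map_zero]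
  · intro p _ hp
    rw [Finset.mem_range] at hp
    rw [contraction_of_lt (by omega), map_zero]

/-- The product formula for the chaos maps. -/
lemma chaos_mul_chaos {n m : ℕ} {f : L2 n} {g : L2 m}
    (hf : f ∈ tensorSpan hχ n) (hg : g ∈ tensorSpan hχ m) :
    chaos hχ X n f * chaos hχ X m g =
      ∑ p ∈ Finset.range (n + 1), chaos hχ X ((n - p) + (m - p)) (contraction p f g) := by
  induction hf, hg using Submodule.span_induction₂ with
  | mem_mem x y hx hy =>
    obtain ⟨w, rfl⟩ := hx
    obtain ⟨u, rfl⟩ := hy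
    exact chaos_mul_chaos_tensor hχ X w u
  | zero_left y hy => simp [← contractionL_apply]
  | zero_right x hx => simp [← contractionL_apply]
  | add_left x y z _ _ _ hx hy =>
    simp only [contraction_add_left, map_add, add_mul, hx, hy, Finset.sum_add_distrib]
  | add_right x y z _ _ _ hx hy =>
    simp only [contraction_add_right, map_add, mul_add, hx, hy, Finset.sum_add_distrib]
  | smul_left c x y _ _ h =>
    simp only [contraction_smul_left, map_smul, smul_mul_assoc, h, Finset.smul_sum]
  | smul_right c x y _ _ h =>
    simp only [contraction_smul_right, map_smul, mul_smul_comm, h, Finset.smul_sum]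

variable {X}

lemma star_chaos (hX : ∀ i, IsSelfAdjoint (X i)) {n : ℕ} {f : L2 n} (hf : f ∈ tensorSpan hχ n) :
    star (chaos hχ X n f) = chaos hχ X n (adjoint f) := by
  induction hf using Submodule.span_induction with
  | mem x hx =>
    obtain ⟨w, rfl⟩ := hx
    rw [adjoint_tensor, chaos_tensor, chaos_tensor, star_wick hX]
    congr 1
    apply List.ext_getElem
    · simp
    · intro i h1 h2
      simp only [List.getElem_reverse, List.getElem_ofFn, List.length_ofFn]
      congr 1
      ext
      simp [Fin.val_rev]
      omega
  | zero =>
    have h : adjoint (0 : L2 n) = 0 := by simpa using adjoint_smul 0 (0 : L2 n)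
    rw [h, map_zero, star_zero]
  | add x y _ _ hx hy => rw [adjoint_add, map_add, map_add, star_add, hx, hy]
  | smul c x _ h => rw [adjoint_smul, map_smul, map_smul, star_smul, h]

variable {φ : A →ₗ[ℂ] ℂ}

lemma map_star_chaos_mul_wick (hφ : IsFaithfulTrace φ) (hX : IsWickCentred φ X) {n : ℕ}
    (f : L2 n) (v : List ι) : φ (star (chaos hχ X n f) * wick X v) =
      ∑ w : Fin n → ι, if List.ofFn w = v then star (inner ℂ (tensor hχ w) f) else 0 := by
  rw [chaos_apply, star_sum, Finset.sum_mul, map_sum]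
  refine Finset.sum_congr rfl fun w _ => ?_
  rw [star_smul, smul_mul_assoc, map_smul, hX.map_star_wick_mul_wick hφ]
  simp

/-- The Wigner isometry. -/
lemma map_star_chaos_mul_chaos (hφ : IsFaithfulTrace φ) (hX : IsWickCentred φ X) {n : ℕ}
    (f : L2 n) {g : L2 n} (hg : g ∈ tensorSpan hχ n) :
    φ (star (chaos hχ X n f) * chaos hχ X n g) = inner ℂ f g := by
  induction hg using Submodule.span_induction with
  | mem x hx =>
    obtain ⟨u, rfl⟩ := hx
    rw [chaos_tensor, map_star_chaos_mul_wick hχ hφ hX]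
    simp only [List.ofFn_inj]
    rw [Finset.sum_ite_eq' Finset.univ u]
    simp
  | zero => simp
  | add x y _ _ hx hy => rw [map_add, mul_add, map_add, hx, hy, inner_add_right]
  | smul c x _ h => rw [map_smul, mul_smul_comm, map_smul, h, inner_smul_right, smul_eq_mul]

lemma map_star_chaos_mul_chaos_of_ne (hφ : IsFaithfulTrace φ) (hX : IsWickCentred φ X)
    {n m : ℕ} (hnm : n ≠ m) (f : L2 n) (g : L2 m) :
    φ (star (chaos hχ X n f) * chaos hχ X m g) = 0 := by
  rw [chaos_apply hχ X g, Finset.mul_sum, map_sum]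
  refine Finset.sum_eq_zero fun u _ => ?_
  rw [mul_smul_comm, map_smul, map_star_chaos_mul_wick hχ hφ hX, Finset.sum_eq_zero, smul_zero]
  intro w _
  rw [if_neg]
  intro h
  exact hnm (by simpa using congr_arg List.length h)

/-- Orthogonality of the chaoses of different degrees. -/
lemma map_star_sum_chaos_mul (hφ : IsFaithfulTrace φ) (hX : IsWickCentred φ X) {κ : Type*}
    (s : Finset κ) (d : κ → ℕ) (h : ∀ k, L2 (d k)) (hh : ∀ k ∈ s, h k ∈ tensorSpan hχ (d k))
    (hd : ∀ k ∈ s, ∀ l ∈ s, k ≠ l → d k = d l → h k = 0 ∨ h l = 0) :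
    φ (star (∑ k ∈ s, chaos hχ X (d k) (h k)) * ∑ k ∈ s, chaos hχ X (d k) (h k)) =
      ((∑ k ∈ s, ‖h k‖ ^ 2 : ℝ) : ℂ) := by
  rw [star_sum, Finset.sum_mul_sum, map_sum]
  push_cast
  refine Finset.sum_congr rfl fun k hk => ?_
  rw [map_sum, Finset.sum_eq_single_of_mem k hk]
  · rw [map_star_chaos_mul_chaos hχ hφ hX _ (hh k hk), inner_self_eq_norm_sq_to_K]
    simp
  · intro l hl hlk
    by_cases hdk : d k = d l
    · rcases hd k hk l hl hlk.symm hdk with h0 | h0 <;> simp [h0]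
    · exact map_star_chaos_mul_chaos_of_ne hχ hφ hX hdk _ _

lemma map_star_chaos_mul_self (hφ : IsFaithfulTrace φ) (hX : IsWickCentred φ X) {n : ℕ}
    {f : L2 n} (hf : f ∈ tensorSpan hχ n) :
    φ (star (chaos hχ X n f) * chaos hχ X n f) = ((‖f‖ ^ 2 : ℝ) : ℂ) := by
  rw [map_star_chaos_mul_chaos hχ hφ hX _ hf, inner_self_eq_norm_sq_to_K]
  simp

/-- The fourth moment of a homogeneous chaos. -/
lemma map_chaos_fourth (hφ : IsFaithfulTrace φ) (hX : IsWickCentred φ X) {n : ℕ}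
    {f : L2 n} (hf : f ∈ tensorSpan hχ n) :
    φ ((chaos hχ X n f * star (chaos hχ X n f)) ^ 2) =
      ((∑ p ∈ Finset.range (n + 1), ‖contraction p f (adjoint f)‖ ^ 2 : ℝ) : ℂ) := by
  -- Self-adjointness turns the square into `star Y * Y` with `Y = F * star F`, so the fourth moment
  -- is the squared `L²(φ)` norm of the product formula.
  have hsa : chaos hχ X n f * star (chaos hχ X n f) =
      star (chaos hχ X n f * star (chaos hχ X n f)) := by simp
  have ha := adjoint_mem_tensorSpan hχ hf
  rw [pow_two]
  nth_rw 1 [hsa]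
  rw [star_chaos hχ hX.selfAdjoint hf, chaos_mul_chaos hχ X hf ha]
  refine map_star_sum_chaos_mul hχ hφ hX (Finset.range (n + 1)) (fun p => (n - p) + (n - p))
    (fun p => contraction p f (adjoint f))
    (fun p _ => contraction_mem_tensorSpan hχ p hf ha) ?_
  intro p hp q hq hpq h
  simp only [Finset.mem_range] at hp hq
  omega

/-- The full contraction is a scalar. In the expansion of `φ(F F*) = ‖f‖²` only the degree-zero term
`p = n` survives, which gives the lower bound; the upper bound is Cauchy–Schwarz. -/
lemma norm_contraction_self_adjoint (hφ : IsFaithfulTrace φ) (hX : IsWickCentred φ X) {n : ℕ}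
    {f : L2 n} (hf : f ∈ tensorSpan hχ n) : ‖contraction n f (adjoint f)‖ = ‖f‖ ^ 2 := by
  apply le_antisymm
  · have := norm_contraction_le n f (adjoint f)
    rwa [norm_adjoint, ← pow_two] at this
  have ha := adjoint_mem_tensorSpan hχ hf
  have h1 : φ (chaos hχ X n f * star (chaos hχ X n f)) = ((‖f‖ ^ 2 : ℝ) : ℂ) := by
    rw [hφ.trace, map_star_chaos_mul_self hχ hφ hX hf]
  have h2 : (1 : A) = star (wick X []) := by simp [wick_nil]
  rw [star_chaos hχ hX.selfAdjoint hf, chaos_mul_chaos hχ X hf ha, map_sum,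
    Finset.sum_eq_single_of_mem n (by simp)] at h1
  · have h3 : ∀ c : L2 ((n - n) + (n - n)), ‖φ (chaos hχ X _ c)‖ ≤ ‖c‖ := by
      intro c
      rw [chaos_apply, Finset.sum_eq_single_of_mem
        (fun i => absurd i.2 (by simp)) (Finset.mem_univ _)]
      · rw [map_smul, List.ofFn_eq_nil_iff.2 (by simp), wick_nil, hφ.map_one, smul_eq_mul, mul_one]
        refine (norm_inner_le_norm _ _).trans ?_
        rw [(orthonormal_tensor hχ _).1, one_mul]
      · intro w _ hw
        exact absurd (funext fun i => absurd i.2 (by simp)) hw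
    have h4 := h3 (contraction n f (adjoint f))
    rw [h1, Complex.norm_real, Real.norm_of_nonneg (by positivity)] at h4
    exact h4
  · intro p hp hpn
    rw [Finset.mem_range] at hp
    rw [chaos_apply, map_sum]
    refine Finset.sum_eq_zero fun w _ => ?_
    rw [map_smul, hX.map_wick _ (by rw [Ne, List.ofFn_eq_nil_iff]; omega), smul_zero]

end Chaos

/-! ### Haagerup's inequality -/

section Haagerup

variable {A ι : Type*} [CStarAlgebra A] [DecidableEq ι]

/-- The span of the Wick words. -/
noncomputable def wickSpan (X : ι → A) : Submodule ℂ A := Submodule.span ℂ (Set.range (wick X))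

lemma mul_mem_wickSpan {X : ι → A} {a b : A} (ha : a ∈ wickSpan X) (hb : b ∈ wickSpan X) :
    a * b ∈ wickSpan X := by
  induction ha, hb using Submodule.span_induction₂ with
  | mem_mem x y hx hy =>
    obtain ⟨w, rfl⟩ := hx
    obtain ⟨u, rfl⟩ := hy
    rw [← w.reverse_reverse, wick_reverse_mul_wick]
    refine Submodule.sum_mem _ fun p _ => ?_
    split_ifs
    · exact Submodule.subset_span ⟨_, rfl⟩
    · exact zero_mem _
  | zero_left y hy => rw [zero_mul]; exact zero_mem _
  | zero_right x hx => rw [mul_zero]; exact zero_mem _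
  | add_left x y z _ _ _ hx hy => rw [add_mul]; exact add_mem hx hy
  | add_right x y z _ _ _ hx hy => rw [mul_add]; exact add_mem hx hy
  | smul_left c x y _ _ h => rw [smul_mul_assoc]; exact Submodule.smul_mem _ _ h
  | smul_right c x y _ _ h => rw [mul_smul_comm]; exact Submodule.smul_mem _ _ h

lemma one_mem_wickSpan (X : ι → A) : 1 ∈ wickSpan X :=
  Submodule.subset_span ⟨[], wick_nil X⟩

variable [Fintype ι] {χ : ι → ℝ → ℝ} (hχ : IsOrthonormalSystem χ) {X : ι → A}

lemma chaos_mem_wickSpan (X : ι → A) {n : ℕ} (f : L2 n) : chaos hχ X n f ∈ wickSpan X := by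
  rw [chaos_apply]
  exact Submodule.sum_mem _ fun w _ =>
    Submodule.smul_mem _ _ (Submodule.subset_span ⟨_, rfl⟩)

lemma exists_chaos_decomposition {b : A} (hb : b ∈ wickSpan X) :
    ∃ (s : Finset ℕ) (g : ∀ m, L2 m), (∀ m, g m ∈ tensorSpan hχ m) ∧
      b = ∑ m ∈ s, chaos hχ X m (g m) := by
  have h1 : wickSpan X ≤ ⨆ m, (tensorSpan hχ m).map (chaos hχ X m).toLinearMap := by
    rw [wickSpan, Submodule.span_le]
    rintro _ ⟨w, rfl⟩
    refine Submodule.mem_iSup_of_mem w.length ⟨tensor hχ w.get, ?_, ?_⟩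
    · exact Submodule.subset_span ⟨_, rfl⟩
    · exact (chaos_tensor hχ X w.get).trans (by rw [List.ofFn_get])
  obtain ⟨F, hF, hFb⟩ := (Submodule.mem_iSup_iff_exists_finsupp _ _).1 (h1 hb)
  choose g hg hgF using hF
  exact ⟨F.support, g, hg, by rw [← hFb]; exact Finset.sum_congr rfl fun m _ => (hgF m).symm⟩

variable {φ : A →ₗ[ℂ] ℂ}

/-- For fixed `p`, the contractions of `f` with the components of `b` lie in orthogonal chaoses, so
the `p`-th part of the product has `L²(φ)` norm at most `‖f‖` times that of `b`. There are `n + 1`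
such parts, whence the factor. -/
lemma re_map_chaos_mul_le (hφ : IsFaithfulTrace φ) (hX : IsWickCentred φ X) {n : ℕ}
    {f : L2 n} (hf : f ∈ tensorSpan hχ n) {b : A} (hb : b ∈ wickSpan X) :
    (φ (star (chaos hχ X n f * b) * (chaos hχ X n f * b))).re ≤
      ((n + 1) * ‖f‖) ^ 2 * (φ (star b * b)).re := by
  obtain ⟨s, g, hg, rfl⟩ := exists_chaos_decomposition hχ hb
  have h1 : chaos hχ X n f * ∑ m ∈ s, chaos hχ X m (g m) =
      ∑ p ∈ Finset.range (n + 1), ∑ m ∈ s,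
        chaos hχ X ((n - p) + (m - p)) (contraction p f (g m)) := by
    rw [Finset.sum_comm, Finset.mul_sum]
    exact Finset.sum_congr rfl fun m _ => chaos_mul_chaos hχ X hf (hg m)
  have h2 : ∀ p, (φ (star (∑ m ∈ s, chaos hχ X ((n - p) + (m - p)) (contraction p f (g m))) *
      ∑ m ∈ s, chaos hχ X ((n - p) + (m - p)) (contraction p f (g m)))).re ≤
      ‖f‖ ^ 2 * ∑ m ∈ s, ‖g m‖ ^ 2 := by
    intro p
    rw [map_star_sum_chaos_mul hχ hφ hX s (fun m => (n - p) + (m - p))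
      (fun m => contraction p f (g m)) (fun m _ => contraction_mem_tensorSpan hχ p hf (hg m)),
      Complex.ofReal_re, Finset.mul_sum]
    · refine Finset.sum_le_sum fun m _ => ?_
      rw [← mul_pow]
      exact pow_le_pow_left₀ (norm_nonneg _) (norm_contraction_le p f (g m)) 2
    -- Truncated subtraction makes the degrees coincide only when `k` or `l` is below `p`, and the
    -- contraction is then zero.
    · intro k _ l _ hkl hd
      by_cases hk : p ≤ k
      · by_cases hl : p ≤ l
        · omega
        · exact Or.inr (contraction_of_lt (by omega) _ _)
      · exact Or.inl (contraction_of_lt (by omega) _ _)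
  have h3 : (φ (star (∑ m ∈ s, chaos hχ X m (g m)) * ∑ m ∈ s, chaos hχ X m (g m))).re =
      ∑ m ∈ s, ‖g m‖ ^ 2 := by
    rw [map_star_sum_chaos_mul hχ hφ hX s (fun m => m) g (fun m _ => hg m)
      (fun k _ l _ hkl hd => absurd hd hkl), Complex.ofReal_re]
  rw [h1, h3]
  refine (hφ.re_map_sum_le _ _).trans ?_
  have h4 := Finset.sum_le_sum fun p (_ : p ∈ Finset.range (n + 1)) => h2 p
  rw [Finset.sum_const, nsmul_eq_mul] at h4
  refine (mul_le_mul_of_nonneg_left h4 (by positivity)).trans (le_of_eq ?_)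
  rw [Finset.card_range]
  push_cast
  ring

/-- Haagerup's inequality for a homogeneous chaos. -/
lemma norm_chaos_le (hφ : IsFaithfulTrace φ) (hX : IsWickCentred φ X) {n : ℕ}
    {f : L2 n} (hf : f ∈ tensorSpan hχ n) : ‖chaos hχ X n f‖ ≤ (n + 1) * ‖f‖ := by
  set T := chaos hχ X n f with hT
  set C : ℝ := (n + 1) * ‖f‖ with hC
  have hC0 : 0 ≤ C := by positivity
  have hTs : star T = chaos hχ X n (adjoint f) := star_chaos hχ hX.selfAdjoint hf
  set a := star T * T with ha
  have haB : a ∈ wickSpan X := by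
    rw [ha, hTs]
    exact mul_mem_wickSpan (chaos_mem_wickSpan hχ X _) (chaos_mem_wickSpan hχ X _)
  have hasa : star a = a := by simp [ha]
  -- The `L²(φ)` bound is used once for `T` and once for `star T`.
  have hstep : ∀ b ∈ wickSpan X, (φ (star (a * b) * (a * b))).re ≤
      C ^ 4 * (φ (star b * b)).re := by
    intro b hb
    have h1 := re_map_chaos_mul_le hχ hφ hX hf hb
    have h2 := re_map_chaos_mul_le hχ hφ hX (adjoint_mem_tensorSpan hχ hf)
      (mul_mem_wickSpan (chaos_mem_wickSpan hχ X f) hb)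
    rw [norm_adjoint, ← hTs, ← hT, ← mul_assoc (star T), ← ha] at h2
    refine h2.trans ((mul_le_mul_of_nonneg_left h1 (by positivity)).trans (le_of_eq ?_))
    ring
  have hpow : ∀ j : ℕ, a ^ j ∈ wickSpan X ∧ (φ (star (a ^ j) * a ^ j)).re ≤ (C ^ 4) ^ j := by
    intro j
    induction j with
    | zero => simp [one_mem_wickSpan, hφ.map_one]
    | succ j ih =>
      rw [pow_succ' a]
      refine ⟨mul_mem_wickSpan haB ih.1, (hstep _ ih.1).trans ?_⟩
      rw [pow_succ' (C ^ 4)]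
      exact mul_le_mul_of_nonneg_left ih.2 (by positivity)
  -- Iterating from `1` gives `φ(a ^ (2j)) ≤ C ^ (4j)`, and a faithful trace recovers the operator
  -- norm from these moments. Only elements of `wickSpan X` occur, so no density of that span is
  -- needed.
  have h1 : ‖star a * a‖ ≤ C ^ 4 := by
    refine hφ.norm_le_of_moments a (by positivity) fun j => ?_
    have := (hpow j).2
    rw [star_pow, hasa, ← pow_add, ← two_mul, pow_mul, pow_two] at this
    rwa [hasa]
  rw [CStarRing.norm_star_mul_self, ha, CStarRing.norm_star_mul_self] at h1
  refine le_of_pow_le_pow_left₀ (n := 4) (by norm_num) hC0 ?_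
  calc ‖T‖ ^ 4 = ‖T‖ * ‖T‖ * (‖T‖ * ‖T‖) := by ring
    _ ≤ C ^ 4 := h1

end Haagerup

/-! ### Density of the off-diagonal step functions -/

section Density

lemma orthant_eq_restrict (n : ℕ) :
    orthant n = (volume : Measure (Fin n → ℝ)).restrict (Set.univ.pi fun _ => Set.Ici 0) := by
  rw [orthant, volume_pi, Measure.restrict_pi_pi]

/-- Two coordinates agree only on a proper linear subspace, which is Lebesgue null. -/
lemma ae_orthant_injective (n : ℕ) :
    ∀ᵐ x ∂(orthant n), Function.Injective x ∧ ∀ i, 0 ≤ x i := by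
  rw [orthant_eq_restrict]
  have h1 : ∀ i j : Fin n, i ≠ j → ∀ᵐ x : Fin n → ℝ, x i ≠ x j := by
    intro i j hij
    have h2 := Measure.addHaar_submodule (volume : Measure (Fin n → ℝ))
      (LinearMap.ker (LinearMap.proj (R := ℝ) (φ := fun _ : Fin n => ℝ) i - LinearMap.proj j))
      (by
        intro h
        have h3 : Pi.single i (1 : ℝ) ∈ (⊤ : Submodule ℝ (Fin n → ℝ)) := trivial
        rw [← h] at h3
        simp [hij.symm] at h3)
    rw [ae_iff]
    convert h2 using 2
    ext x
    simp [sub_eq_zero]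
  have h2 : ∀ᵐ x : Fin n → ℝ, ∀ i j, i ≠ j → x i ≠ x j := by
    simp only [ae_all_iff]
    exact h1
  filter_upwards [ae_restrict_of_ae h2, ae_restrict_mem
    (MeasurableSet.univ_pi fun _ => measurableSet_Ici)] with x h3 h4
  exact ⟨fun i j hij => by_contra fun hne => h3 i j hne hij, fun i => h4 i trivial⟩

lemma isPiSystem_box (n : ℕ) : IsPiSystem (Set.univ.pi '' Set.univ.pi
    fun _ : Fin n => {S : Set ℝ | ∃ l u, l ≤ u ∧ Set.Icc l u = S}) :=
  IsPiSystem.pi fun _ => isPiSystem_Icc id id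

lemma generateFrom_box (n : ℕ) : MeasurableSpace.pi = MeasurableSpace.generateFrom
    (Set.univ.pi '' Set.univ.pi
      fun _ : Fin n => {S : Set ℝ | ∃ l u, l ≤ u ∧ Set.Icc l u = S}) := by
  refine (generateFrom_eq_pi (fun _ => ?_) fun _ => ?_).symm
  · rw [← borel_eq_generateFrom_Icc, ← BorelSpace.measurable_eq (α := ℝ)]
  · refine ⟨fun k : ℕ => Set.Icc (-k : ℝ) k, fun k => ⟨-k, k, ?_, rfl⟩, ?_⟩
    · have : (0 : ℝ) ≤ k := Nat.cast_nonneg k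
      linarith
    · rw [Set.eq_univ_iff_forall]
      intro x
      obtain ⟨k, hk⟩ := exists_nat_ge |x|
      exact Set.mem_iUnion.2 ⟨k, abs_le.1 hk⟩

/-- A function whose integrals over all off-diagonal boxes vanish is zero on any such box. -/
lemma ae_eq_zero_on_box {n : ℕ} (f : L2 n)
    (hf : ∀ c d : Fin n → ℝ, (∀ i, 0 ≤ c i) → (∀ i, c i ≤ d i) →
      Pairwise (fun i j => Disjoint (Set.Icc (c i) (d i)) (Set.Icc (c j) (d j))) →
      ∫ x in Set.univ.pi fun i => Set.Icc (c i) (d i), f x ∂(orthant n) = 0)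
    (c d : Fin n → ℝ) (hc : ∀ i, 0 ≤ c i) (hcd : ∀ i, c i ≤ d i)
    (hdisj : Pairwise (fun i j => Disjoint (Set.Icc (c i) (d i)) (Set.Icc (c j) (d j)))) :
    ∀ᵐ x ∂(orthant n).restrict (Set.univ.pi fun i => Set.Icc (c i) (d i)), f x = 0 := by
  set B := Set.univ.pi fun i => Set.Icc (c i) (d i) with hB
  have hBc : IsCompact B := isCompact_univ_pi fun i => isCompact_Icc
  have hBm : MeasurableSet B := MeasurableSet.univ_pi fun i => measurableSet_Icc
  have hfin : IsFiniteMeasure ((orthant n).restrict B) :=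
    ⟨by rw [Measure.restrict_apply_univ]; exact hBc.measure_lt_top⟩
  have hint : Integrable f ((orthant n).restrict B) :=
    ((Lp.memLp f).restrict B).integrable one_le_two
  refine hint.ae_eq_zero_of_forall_setIntegral_eq_zero fun s hs _ => ?_
  -- A π-λ argument: the intersection of any box with an off-diagonal box is empty or again an
  -- off-diagonal box, where the integral vanishes by hypothesis.
  induction s, hs using MeasurableSpace.induction_on_inter (generateFrom_box n)
    (isPiSystem_box n) with
  | empty => simp
  | basic t ht =>
    obtain ⟨S, hS, rfl⟩ := ht
    choose l u hlu hS using fun i => hS i trivial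
    have h1 : Set.univ.pi S ∩ B =
        Set.univ.pi fun i => Set.Icc (max (l i) (c i)) (min (u i) (d i)) := by
      rw [hB, ← Set.pi_inter_distrib]
      congr 1
      ext1 i
      rw [← hS i, Set.Icc_inter_Icc]
    have h2 : MeasurableSet (Set.univ.pi S) :=
      MeasurableSet.univ_pi fun i => by rw [← hS i]; exact measurableSet_Icc
    rw [Measure.restrict_restrict h2, h1]
    by_cases hne : ∀ i, max (l i) (c i) ≤ min (u i) (d i)
    · refine hf _ _ (fun i => (hc i).trans (le_max_right _ _)) hne fun i j hij => ?_
      exact (hdisj hij).mono (Set.Icc_subset_Icc (le_max_right _ _) (min_le_right _ _))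
        (Set.Icc_subset_Icc (le_max_right _ _) (min_le_right _ _))
    · push Not at hne
      obtain ⟨i, hi⟩ := hne
      have h3 : (Set.univ.pi fun i => Set.Icc (max (l i) (c i)) (min (u i) (d i))) = ∅ :=
        Set.univ_pi_eq_empty (i := i) (Set.Icc_eq_empty_of_lt hi)
      rw [h3]
      simp
  | compl t ht ih =>
    have h1 := integral_add_compl ht hint
    have h2 : ∫ x, f x ∂(orthant n).restrict B = 0 := hf c d hc hcd hdisj
    rw [ih (measure_lt_top _ _), zero_add, h2] at h1
    exact h1
  | iUnion F hd hm ih =>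
    rw [integral_iUnion hm hd hint.integrableOn]
    simp [ih _ (measure_lt_top _ _)]

/-- Almost every point has distinct coordinates and hence a small off-diagonal cube around it, on
which `f` vanishes almost everywhere; locally null sets are null. -/
lemma eq_zero_of_forall_box {n : ℕ} (f : L2 n)
    (hf : ∀ c d : Fin n → ℝ, (∀ i, 0 ≤ c i) → (∀ i, c i ≤ d i) →
      Pairwise (fun i j => Disjoint (Set.Icc (c i) (d i)) (Set.Icc (c j) (d j))) →
      ∫ x in Set.univ.pi fun i => Set.Icc (c i) (d i), f x ∂(orthant n) = 0) : f = 0 := by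
  rw [Lp.eq_zero_iff_ae_eq_zero]
  have hnull : orthant n {x | f x ≠ 0 ∧ Function.Injective x ∧ ∀ i, 0 ≤ x i} = 0 := by
    refine measure_null_of_locally_null _ fun x hx => ?_
    obtain ⟨-, hinj, hpos⟩ := hx
    have h1 : ∀ᶠ ε : ℝ in 𝓝[>] 0, ∀ i j, i ≠ j → 2 * ε < |x i - x j| := by
      simp only [eventually_all]
      intro i j hij
      have h2 : 0 < |x i - x j| := abs_pos.2 (sub_ne_zero.2 fun h => hij (hinj h))
      have h3 : ∀ᶠ ε : ℝ in 𝓝 0, 2 * ε < |x i - x j| := by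
        refine (continuous_const.mul continuous_id).tendsto' 0 0 (by simp) |>.eventually_lt_const h2
      exact h3.filter_mono nhdsWithin_le_nhds
    obtain ⟨ε, hε, hε0⟩ := (h1.and self_mem_nhdsWithin).exists
    replace hε0 : 0 < ε := hε0
    -- Sides of length at most `2ε`, less than every gap between coordinates, are disjoint; the
    -- maximum with 0 keeps the cube in the orthant.
    have h2 := ae_eq_zero_on_box f hf (fun i => max 0 (x i - ε)) (fun i => x i + ε)
      (fun i => le_max_left _ _)
      (fun i => max_le (by linarith [hpos i]) (by linarith)) (by
        intro i j hij
        rw [Set.disjoint_left]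
        intro y hy hy'
        have h3 := hε i j hij
        have h4 := (le_max_right _ _).trans hy.1
        have h5 := (le_max_right _ _).trans hy'.1
        have h6 := hy.2
        have h7 := hy'.2
        have h8 : |x i - x j| ≤ 2 * ε := abs_le.2 ⟨by linarith, by linarith⟩
        linarith)
    rw [ae_restrict_iff' (MeasurableSet.univ_pi fun i => measurableSet_Icc), ae_iff] at h2
    refine ⟨_, ?_, h2⟩
    have h3 : (Set.univ.pi fun i => Set.Icc (x i - ε) (x i + ε)) ∈ 𝓝 x :=
      set_pi_mem_nhds Set.finite_univ fun i _ => Icc_mem_nhds (by linarith) (by linarith)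
    filter_upwards [mem_nhdsWithin_of_mem_nhds h3, self_mem_nhdsWithin] with y hy hy'
    simp only [Classical.not_imp]
    exact ⟨fun i _ => ⟨max_le (hy'.2.2 i) (hy i trivial).1, (hy i trivial).2⟩, hy'.1⟩
  filter_upwards [ae_orthant_injective n, measure_eq_zero_iff_ae_notMem.1 hnull] with x h1 h2
  by_contra h
  exact h2 ⟨h, h1⟩

variable {A : Type*} [CStarAlgebra A]

/-- Off-diagonal step functions are dense in `L²(ℝ₊ⁿ)`. -/
lemma dense_stepGraph_fst (S : ℝ≥0 → A) (n : ℕ) :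
    ((stepGraph S n).map (LinearMap.fst ℂ (L2 n) A)).topologicalClosure = ⊤ := by
  rw [Submodule.topologicalClosure_eq_top_iff, Submodule.eq_bot_iff]
  intro f hf
  refine eq_zero_of_forall_box f fun c d hc hcd hdisj => ?_
  have hBm : MeasurableSet (Set.univ.pi fun i => Set.Icc (c i) (d i)) :=
    MeasurableSet.univ_pi fun i => measurableSet_Icc
  have hB : orthant n (Set.univ.pi fun i => Set.Icc (c i) (d i)) ≠ ⊤ :=
    (isCompact_univ_pi fun i => isCompact_Icc).measure_lt_top.ne
  -- The integral over a box is the inner product with its indicator, an element of the span to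
  -- which `f` is orthogonal.
  rw [← L2.inner_indicatorConstLp_one (𝕜 := ℂ) hBm hB f]
  refine (Submodule.mem_orthogonal _ _).1 hf _ ⟨(indicatorConstLp 2 hBm hB (1 : ℂ),
    (List.ofFn fun i => S ⟨d i, (hc i).trans (hcd i)⟩ - S ⟨c i, hc i⟩).prod), ?_, rfl⟩
  refine Submodule.subset_span ⟨fun i => ⟨c i, hc i⟩, fun i => ⟨d i, (hc i).trans (hcd i)⟩,
    hcd, ?_, indicatorConstLp_coeFn (hs := hBm) (hμs := hB), rfl⟩
  intro i j hij
  rw [Set.disjoint_left]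
  intro y hy hy'
  exact Set.disjoint_left.1 (hdisj hij) (show (y : ℝ) ∈ Set.Icc (c i) (d i) from ⟨hy.1, hy.2⟩)
    ⟨hy'.1, hy'.2⟩

end Density

/-! ### Partitions -/

section Partition

/-- One telescoping identity serves both the indicators and the increments of the process, so the
two expand with the same coefficients. -/
lemma sum_sub_eq_of_le {M : Type*} [AddCommGroup M] {m : ℕ} (F : Fin (m + 1) → M)
    (a b : Fin (m + 1)) (hab : a ≤ b) :
    ∑ j with a ≤ Fin.castSucc j ∧ j.succ ≤ b, (F j.succ - F j.castSucc) = F b - F a := by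
  induction b using Fin.induction with
  | zero =>
    obtain rfl : a = 0 := le_antisymm hab (Fin.zero_le _)
    rw [sub_self, Finset.filter_false_of_mem, Finset.sum_empty]
    rintro j - ⟨-, h⟩
    exact absurd h (by simp)
  | succ k ih =>
    rcases hab.eq_or_lt with rfl | hlt
    · rw [sub_self, Finset.filter_false_of_mem, Finset.sum_empty]
      rintro j - ⟨h1, h2⟩
      simp only [Fin.le_def, Fin.val_succ, Fin.val_castSucc] at h1 h2
      omega
    · have hak : a ≤ k.castSucc := by
        simp only [Fin.le_def, Fin.lt_def, Fin.val_succ, Fin.val_castSucc] at *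
        omega
      have h1 : Finset.univ.filter (fun j : Fin m => a ≤ Fin.castSucc j ∧ j.succ ≤ k.succ) =
          insert k (Finset.univ.filter
            (fun j : Fin m => a ≤ Fin.castSucc j ∧ j.succ ≤ k.castSucc)) := by
        ext j
        simp only [Finset.mem_filter, Finset.mem_univ, true_and, Finset.mem_insert, Fin.le_def,
          Fin.val_succ, Fin.val_castSucc, Fin.ext_iff] at *
        omega
      rw [h1, Finset.sum_insert, ih hak]
      · abel
      · simp [Fin.le_def]

variable {m : ℕ} {t : Fin (m + 1) → ℝ≥0}

/-- The length of the `j`-th interval of a partition. -/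
def stepLength (t : Fin (m + 1) → ℝ≥0) (j : Fin m) : ℝ := (t j.succ : ℝ) - t j.castSucc

/-- The normalized indicator function of the `j`-th interval of a partition. -/
noncomputable def stepFun (t : Fin (m + 1) → ℝ≥0) (j : Fin m) : ℝ → ℝ :=
  (Set.Ico (t j.castSucc : ℝ) (t j.succ)).indicator fun _ => (√(stepLength t j))⁻¹

lemma stepLength_pos (ht : StrictMono t) (j : Fin m) : 0 < stepLength t j :=
  sub_pos.2 (NNReal.coe_lt_coe.2 (ht (Fin.castSucc_lt_succ)))

lemma isOrthonormalSystem_stepFun (ht : StrictMono t) : IsOrthonormalSystem (stepFun t) where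
  measurable j := measurable_const.indicator measurableSet_Ico
  memLp j := by
    refine memLp_indicator_const 2 measurableSet_Ico _ (Or.inr ?_)
    exact ((Measure.restrict_apply_le _ _).trans_lt (by simp)).ne
  integral i j := by
    have hv := stepLength_pos ht i
    split_ifs with hij
    · subst hij
      have h1 : (fun x => stepFun t i x * stepFun t i x) =
          (Set.Ico (t i.castSucc : ℝ) (t i.succ)).indicator fun _ => (stepLength t i)⁻¹ := by
        ext x
        by_cases hx : x ∈ Set.Ico (t i.castSucc : ℝ) (t i.succ)
        · simp only [stepFun, Set.indicator_of_mem hx]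
          rw [← mul_inv, Real.mul_self_sqrt hv.le]
        · simp [stepFun, Set.indicator_of_notMem hx]
      rw [h1, integral_indicator_const _ measurableSet_Ico, measureReal_restrict_apply
        measurableSet_Ico, Set.inter_eq_left.2, Real.volume_real_Ico_of_le]
      · rw [smul_eq_mul, ← stepLength, mul_inv_cancel₀ hv.ne']
      · exact (sub_pos.1 hv).le
      · exact fun x hx => (NNReal.coe_nonneg _).trans hx.1
    · have h1 : (fun x => stepFun t i x * stepFun t j x) = 0 := by
        ext x
        by_cases hx : x ∈ Set.Ico (t i.castSucc : ℝ) (t i.succ)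
        · by_cases hy : x ∈ Set.Ico (t j.castSucc : ℝ) (t j.succ)
          · exfalso
            have h2 := ht.lt_iff_lt.1 (NNReal.coe_lt_coe.1 (hx.1.trans_lt hy.2))
            have h3 := ht.lt_iff_lt.1 (NNReal.coe_lt_coe.1 (hy.1.trans_lt hx.2))
            simp only [Fin.lt_def, Fin.val_succ, Fin.val_castSucc] at h2 h3
            exact hij (Fin.ext (by omega))
          · simp [stepFun, Set.indicator_of_notMem hy]
        · simp [stepFun, Set.indicator_of_notMem hx]
      rw [h1]
      simp

variable {A : Type*} [CStarAlgebra A]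

/-- The normalized increments of a process along a partition. -/
noncomputable def stepVar (S : ℝ≥0 → A) (t : Fin (m + 1) → ℝ≥0) (j : Fin m) : A :=
  (((√(stepLength t j))⁻¹ : ℝ) : ℂ) • (S (t j.succ) - S (t j.castSucc))

variable {φ : A →ₗ[ℂ] ℂ} {S : ℝ≥0 → A}

/-- The point at which Brownian motion enters: freeness of the increments, and their semicircular
laws through the Chebyshev polynomials. -/
lemma isWickCentred_stepVar (hS : IsFreeBrownianMotion φ S) (ht : StrictMono t) :
    IsWickCentred φ (stepVar S t) where
  selfAdjoint j := by
    rw [IsSelfAdjoint, stepVar, star_smul, star_sub, (hS.selfAdjoint _).star_eq,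
      (hS.selfAdjoint _).star_eq, Complex.star_def, Complex.conj_ofReal]
  map_wick := by
    have hfree : FreeSubalgebras φ fun j : Fin m =>
      Algebra.adjoin ℂ {S (t j.succ) - S (t j.castSucc)} := hS.free m t ht
    refine map_wick_eq_zero hfree (fun j => ?_) fun j k hk => ?_
    · exact Subalgebra.smul_mem _ (Algebra.subset_adjoin (Set.mem_singleton _)) _
    · refine HasDistribution.map_aeval_S (stepLength_pos ht j) ?_ k hk
      exact hS.law _ _ (ht Fin.castSucc_lt_succ)

lemma indicator_Ico_eq_sum (ht : StrictMono t) {a b : Fin (m + 1)} (hab : a ≤ b) (x : ℝ) :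
    (Set.Ico (t a : ℝ) (t b)).indicator (fun _ => (1 : ℂ)) x =
      ∑ j with a ≤ Fin.castSucc j ∧ j.succ ≤ b,
        (√(stepLength t j) : ℂ) * (stepFun t j x : ℂ) := by
  have hind : ∀ a b : Fin (m + 1), a ≤ b →
      (Set.Ico (t a : ℝ) (t b)).indicator (fun _ => (1 : ℂ)) x =
        (if x < t b then 1 else 0) - (if x < t a then 1 else 0) := by
    intro a b hab
    have h1 : (t a : ℝ) ≤ t b := NNReal.coe_le_coe.2 (ht.monotone hab)
    rw [Set.indicator_apply]
    by_cases h2 : x < t a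
    · simp [h2, h2.trans_le h1]
    · by_cases h3 : x < t b <;> simp [h2, h3, not_lt.1 h2]
  rw [hind a b hab, ← sum_sub_eq_of_le (fun a => if x < t a then (1 : ℂ) else 0) a b hab]
  refine Finset.sum_congr rfl fun j _ => ?_
  rw [← hind _ _ (Fin.castSucc_lt_succ).le, stepFun, Set.indicator_apply, Set.indicator_apply]
  have h := (Real.sqrt_pos.2 (stepLength_pos ht j)).ne'
  split_ifs
  · rw [← Complex.ofReal_mul, mul_inv_cancel₀ h, Complex.ofReal_one]
  · simp

lemma sub_eq_sum_stepVar (ht : StrictMono t) (S : ℝ≥0 → A) {a b : Fin (m + 1)} (hab : a ≤ b) :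
    S (t b) - S (t a) =
      ∑ j with a ≤ Fin.castSucc j ∧ j.succ ≤ b, (√(stepLength t j) : ℂ) • stepVar S t j := by
  rw [← sum_sub_eq_of_le (fun a => S (t a)) a b hab]
  refine Finset.sum_congr rfl fun j _ => ?_
  have h := (Real.sqrt_pos.2 (stepLength_pos ht j)).ne'
  rw [stepVar, smul_smul, ← Complex.ofReal_mul, mul_inv_cancel₀ h, Complex.ofReal_one, one_smul]

lemma ae_box_eq_sum_tensorFun (ht : StrictMono t) {n : ℕ} {a b : Fin n → Fin (m + 1)}
    (hab : ∀ i, a i ≤ b i) :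
    (Set.univ.pi fun i => Set.Icc (t (a i) : ℝ) (t (b i))).indicator (fun _ => (1 : ℂ))
      =ᵐ[orthant n] fun x => ∑ w ∈ Fintype.piFinset fun i =>
        Finset.univ.filter (fun j => a i ≤ Fin.castSucc j ∧ j.succ ≤ b i),
          (∏ i, (√(stepLength t (w i)) : ℂ)) * tensorFun (stepFun t) w x := by
  -- Closed and half-open boxes differ only on these null hyperplanes.
  have h1 : ∀ᵐ x ∂(orthant n), ∀ i, x i ≠ (t (b i) : ℝ) := by
    rw [ae_all_iff]
    intro i
    rw [ae_iff]
    simp only [not_not]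
    exact Measure.pi_hyperplane (fun _ : Fin n => halfLine) i _
  filter_upwards [h1] with x hx
  have h2 : (Set.univ.pi fun i => Set.Icc (t (a i) : ℝ) (t (b i))).indicator
      (fun _ => (1 : ℂ)) x =
      ∏ i, (Set.Ico (t (a i) : ℝ) (t (b i))).indicator (fun _ => (1 : ℂ)) (x i) := by
    by_cases h : ∀ i, x i ∈ Set.Ico (t (a i) : ℝ) (t (b i))
    · rw [Set.indicator_of_mem (show x ∈ _ from fun i _ => ⟨(h i).1, (h i).2.le⟩),
        Finset.prod_eq_one fun i _ => Set.indicator_of_mem (h i) _]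
    · obtain ⟨i, hi⟩ := not_forall.1 h
      rw [Set.indicator_of_notMem, Finset.prod_eq_zero (Finset.mem_univ i)
        (Set.indicator_of_notMem hi _)]
      exact fun hmem => hi ⟨(hmem i trivial).1, lt_of_le_of_ne (hmem i trivial).2 (hx i)⟩
  rw [h2]
  simp only [indicator_Ico_eq_sum ht (hab _)]
  rw [Finset.prod_univ_sum]
  refine Finset.sum_congr rfl fun w _ => ?_
  rw [Finset.prod_mul_distrib, tensorFun]

lemma Lp_coeFn_sum {κ : Type*} {n : ℕ} (s : Finset κ) (f : κ → L2 n) :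
    (∑ k ∈ s, f k : L2 n) =ᵐ[orthant n] fun x => ∑ k ∈ s, f k x := by
  classical
  induction s using Finset.induction_on with
  | empty =>
    simp only [Finset.sum_empty]
    exact Lp.coeFn_zero ℂ 2 (orthant n)
  | insert k s hk ih =>
    rw [Finset.sum_insert hk]
    filter_upwards [Lp.coeFn_add (f k) (∑ k ∈ s, f k), ih] with x h1 h2
    rw [h1, Pi.add_apply, h2, Finset.sum_insert hk]

/-- Step functions along a partition, with their Wigner integrals, lie in the graph of the chaos
map of that partition. -/
lemma chaos_of_box (ht : StrictMono t) (S : ℝ≥0 → A) {n : ℕ} {a b : Fin n → Fin (m + 1)}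
    (hab : ∀ i, a i ≤ b i)
    (hdisj : Pairwise fun i j =>
      Disjoint (Set.Icc (t (a i)) (t (b i))) (Set.Icc (t (a j)) (t (b j))))
    {f : L2 n} (hf : f =ᵐ[orthant n]
      (Set.univ.pi fun i => Set.Icc (t (a i) : ℝ) (t (b i))).indicator (fun _ => (1 : ℂ))) :
    f ∈ tensorSpan (isOrthonormalSystem_stepFun ht) n ∧
      (List.ofFn fun i => S (t (b i)) - S (t (a i))).prod =
        chaos (isOrthonormalSystem_stepFun ht) (stepVar S t) n f := by
  set hχ := isOrthonormalSystem_stepFun ht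
  set W := Fintype.piFinset fun i =>
    Finset.univ.filter (fun j => a i ≤ Fin.castSucc j ∧ j.succ ≤ b i) with hW
  have h1 : f = ∑ w ∈ W, (∏ i, (√(stepLength t (w i)) : ℂ)) • tensor hχ w := by
    apply Lp.ext
    refine (hf.trans (ae_box_eq_sum_tensorFun ht hab)).trans ?_
    have h2 : ∀ᵐ x ∂(orthant n), ∀ w : Fin n → Fin m, tensor hχ w x = tensorFun (stepFun t) w x :=
      ae_all_iff.2 fun w => tensor_coeFn hχ w
    have h3 : ∀ᵐ x ∂(orthant n), ∀ w : Fin n → Fin m,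
        ((∏ i, (√(stepLength t (w i)) : ℂ)) • tensor hχ w : L2 n) x =
          (∏ i, (√(stepLength t (w i)) : ℂ)) • tensor hχ w x :=
      ae_all_iff.2 fun w => Lp.coeFn_smul _ _
    filter_upwards [h2, h3, Lp_coeFn_sum W
      fun w => ((∏ i, (√(stepLength t (w i)) : ℂ)) • tensor hχ w : L2 n)] with x h4 h5 h6
    rw [h6]
    simp only [h5, h4, smul_eq_mul, hW]
  refine ⟨?_, ?_⟩
  · rw [h1]
    exact Submodule.sum_mem _ fun w _ =>
      Submodule.smul_mem _ _ (Submodule.subset_span ⟨w, rfl⟩)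
  · have h2 := (MultilinearMap.mkPiAlgebraFin ℂ n A).map_sum_finset
      (fun i j => (√(stepLength t j) : ℂ) • stepVar S t j)
      (fun i => Finset.univ.filter (fun j => a i ≤ Fin.castSucc j ∧ j.succ ≤ b i))
    simp only [← sub_eq_sum_stepVar ht S (hab _)] at h2
    rw [MultilinearMap.mkPiAlgebraFin_apply] at h2
    rw [h2, h1, map_sum]
    refine Finset.sum_congr rfl fun w hw => ?_
    rw [MultilinearMap.map_smul_univ, map_smul, chaos_tensor, MultilinearMap.mkPiAlgebraFin_apply,
      wick_eq_prod_of_isChain, List.map_ofFn]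
    · rfl
    -- A repeated letter would place one partition point in two of the disjoint intervals. All
    -- letters are thus distinct and the Wick word is the plain product of increments.
    · refine List.Pairwise.isChain (List.nodup_ofFn.2 fun i j hij => ?_)
      by_contra hne
      have h3 : ∀ i, t (w i).castSucc ∈ Set.Icc (t (a i)) (t (b i)) := by
        intro i
        have h4 := Fintype.mem_piFinset.1 hw i
        rw [Finset.mem_filter] at h4
        exact ⟨ht.monotone h4.2.1, ht.monotone ((Fin.castSucc_lt_succ).le.trans h4.2.2)⟩
      exact Set.disjoint_left.1 (hdisj hne) (h3 i) (hij ▸ h3 j)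

/-- The claim covers every partition containing `P`, so that for a sum the union of two point sets
serves both summands. -/
lemma exists_partition_of_mem_stepGraph {n : ℕ} {z : L2 n × A} (hz : z ∈ stepGraph S n) :
    ∃ P : Finset ℝ≥0, ∀ (m : ℕ) (t : Fin (m + 1) → ℝ≥0) (ht : StrictMono t),
      (∀ x ∈ P, x ∈ Set.range t) → z.1 ∈ tensorSpan (isOrthonormalSystem_stepFun ht) n ∧
        z.2 = chaos (isOrthonormalSystem_stepFun ht) (stepVar S t) n z.1 := by
  classical
  induction hz using Submodule.span_induction with
  | mem z hz =>
    obtain ⟨s, u, hsu, hdisj, h1, h2⟩ := hz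
    refine ⟨Finset.univ.image s ∪ Finset.univ.image u, fun m t ht hP => ?_⟩
    choose a ha using fun i => hP (s i) (by simp)
    choose b hb using fun i => hP (u i) (by simp)
    have hab : ∀ i, a i ≤ b i := fun i => ht.le_iff_le.1 (by rw [ha, hb]; exact hsu i)
    obtain rfl : (fun i => t (a i)) = s := funext ha
    obtain rfl : (fun i => t (b i)) = u := funext hb
    rw [h2]
    exact chaos_of_box ht S hab hdisj h1
  | zero => exact ⟨∅, fun m t ht _ => ⟨zero_mem _, by simp⟩⟩
  | add x y _ _ hx hy =>
    obtain ⟨P, hP⟩ := hx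
    obtain ⟨Q, hQ⟩ := hy
    refine ⟨P ∪ Q, fun m t ht h => ?_⟩
    obtain ⟨h1, h2⟩ := hP m t ht fun x hx => h x (Finset.mem_union_left _ hx)
    obtain ⟨h3, h4⟩ := hQ m t ht fun x hx => h x (Finset.mem_union_right _ hx)
    exact ⟨add_mem h1 h3, by rw [Prod.snd_add, Prod.fst_add, map_add, h2, h4]⟩
  | smul c x _ hx =>
    obtain ⟨P, hP⟩ := hx
    refine ⟨P, fun m t ht h => ?_⟩
    obtain ⟨h1, h2⟩ := hP m t ht h
    exact ⟨Submodule.smul_mem _ _ h1, by rw [Prod.smul_snd, Prod.smul_fst, map_smul, h2]⟩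

lemma exists_chaos_of_mem_stepGraph {n : ℕ} {z : L2 n × A} (hz : z ∈ stepGraph S n) :
    ∃ (m : ℕ) (t : Fin (m + 1) → ℝ≥0) (ht : StrictMono t),
      z.1 ∈ tensorSpan (isOrthonormalSystem_stepFun ht) n ∧
        z.2 = chaos (isOrthonormalSystem_stepFun ht) (stepVar S t) n z.1 := by
  classical
  obtain ⟨P, hP⟩ := exists_partition_of_mem_stepGraph hz
  -- Inserting 0 makes the set of points nonempty, hence enumerable by some `Fin (m + 1)`.
  obtain ⟨m, hm⟩ := Nat.exists_eq_succ_of_ne_zero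
    (Finset.card_ne_zero_of_mem (Finset.mem_insert_self 0 P))
  have ht := ((insert 0 P).orderEmbOfFin hm).strictMono
  refine ⟨m, (insert 0 P).orderEmbOfFin hm, ht, hP _ _ ht fun x hx => ?_⟩
  rw [Finset.range_orderEmbOfFin]
  exact Finset.mem_coe.2 (Finset.mem_insert_of_mem hx)

end Partition

/-! ### The Wigner integral -/

section Wigner

variable {A : Type*} [CStarAlgebra A] {φ : A →ₗ[ℂ] ℂ} {S : ℝ≥0 → A} {n : ℕ}

/-- Applied to differences, this shows that the graph is single valued and that convergent kernels
have integrals that are Cauchy in operator norm, so limits stay in `A`. -/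
lemma norm_le_of_mem_stepGraph (hφ : IsFaithfulTrace φ) (hS : IsFreeBrownianMotion φ S)
    {z : L2 n × A} (hz : z ∈ stepGraph S n) : ‖z.2‖ ≤ (n + 1) * ‖z.1‖ := by
  obtain ⟨m, t, ht, h1, h2⟩ := exists_chaos_of_mem_stepGraph hz
  rw [h2]
  exact norm_chaos_le _ hφ (isWickCentred_stepVar hS ht) h1

lemma map_star_mul_self_of_mem_stepGraph (hφ : IsFaithfulTrace φ)
    (hS : IsFreeBrownianMotion φ S) {z : L2 n × A} (hz : z ∈ stepGraph S n) :
    φ (star z.2 * z.2) = ((‖z.1‖ ^ 2 : ℝ) : ℂ) := by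
  obtain ⟨m, t, ht, h1, h2⟩ := exists_chaos_of_mem_stepGraph hz
  rw [h2]
  exact map_star_chaos_mul_self _ hφ (isWickCentred_stepVar hS ht) h1

/-- The extreme contractions `p = 0` and `p = n`, distinct since `n ≥ 1`, each contribute `‖z.1‖ ^
4`. -/
lemma map_fourth_of_mem_stepGraph (hφ : IsFaithfulTrace φ)
    (hS : IsFreeBrownianMotion φ S) (hn : 1 ≤ n) {z : L2 n × A} (hz : z ∈ stepGraph S n) :
    φ ((z.2 * star z.2) ^ 2) = ((2 * ‖z.1‖ ^ 4 +
      ∑ p ∈ Finset.Icc 1 (n - 1), ‖contraction p z.1 (adjoint z.1)‖ ^ 2 : ℝ) : ℂ) := by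
  obtain ⟨m, t, ht, h1, h2⟩ := exists_chaos_of_mem_stepGraph hz
  have hX := isWickCentred_stepVar hS ht
  rw [h2, map_chaos_fourth _ hφ hX h1]
  congr 1
  obtain ⟨k, rfl⟩ : ∃ k, n = k + 1 := ⟨n - 1, by omega⟩
  have hsum : ∀ F : ℕ → ℝ, ∑ p ∈ Finset.Icc 1 k, F p = ∑ p ∈ Finset.range k, F (p + 1) := by
    intro F
    rw [← Finset.Ico_add_one_right_eq_Icc, Finset.sum_Ico_eq_sum_range]
    simp only [Nat.add_sub_cancel, add_comm 1]
  rw [Finset.sum_range_succ, norm_contraction_self_adjoint _ hφ hX h1, Finset.sum_range_succ',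
    norm_contraction_zero, norm_adjoint, Nat.add_sub_cancel,
    hsum fun p => ‖contraction p z.1 (adjoint z.1)‖ ^ 2]
  ring

/-- Every `f ∈ L²(ℝ₊ⁿ)` is a limit of off-diagonal step functions whose Wigner integrals converge
in operator norm. -/
lemma exists_tendsto_stepGraph (hφ : IsFaithfulTrace φ) (hS : IsFreeBrownianMotion φ S)
    (f : L2 n) : ∃ (X : A) (z : ℕ → L2 n × A), (∀ j, z j ∈ stepGraph S n) ∧
      Tendsto (fun j => (z j).1) atTop (𝓝 f) ∧ Tendsto (fun j => (z j).2) atTop (𝓝 X) := by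
  have hf : f ∈ closure
      (((stepGraph S n).map (LinearMap.fst ℂ (L2 n) A) : Submodule ℂ (L2 n)) : Set (L2 n)) := by
    rw [← Submodule.topologicalClosure_coe, dense_stepGraph_fst]
    trivial
  obtain ⟨g, hg, hgf⟩ := mem_closure_iff_seq_limit.1 hf
  choose z hz hzg using hg
  have hzg' : ∀ j, (z j).1 = g j := hzg
  have hcauchy : CauchySeq fun j => (z j).2 := by
    have h1 := hgf.cauchySeq
    rw [Metric.cauchySeq_iff] at h1 ⊢
    intro ε hε
    obtain ⟨N, hN⟩ := h1 (ε / (n + 1)) (by positivity)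
    refine ⟨N, fun i hi j hj => ?_⟩
    have h2 := norm_le_of_mem_stepGraph hφ hS ((stepGraph S n).sub_mem (hz i) (hz j))
    have h3 := hN i hi j hj
    rw [dist_eq_norm, lt_div_iff₀ (by positivity)] at h3
    rw [dist_eq_norm]
    rw [Prod.snd_sub, Prod.fst_sub, hzg', hzg'] at h2
    linarith
  obtain ⟨X, hX⟩ := cauchySeq_tendsto_of_complete hcauchy
  exact ⟨X, z, hz, by simpa only [hzg'] using hgf, hX⟩

lemma isWignerIntegral_of_tendsto (hφ : IsFaithfulTrace φ) {f : L2 n} {X : A}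
    {z : ℕ → L2 n × A} (hz : ∀ j, z j ∈ stepGraph S n)
    (h1 : Tendsto (fun j => (z j).1) atTop (𝓝 f)) (h2 : Tendsto (fun j => (z j).2) atTop (𝓝 X)) :
    IsWignerIntegral φ S f X := by
  refine ⟨z, hz, h1, ?_⟩
  have hc : Continuous fun a : A => φ (star (a - X) * (a - X)) :=
    hφ.continuous.comp (by fun_prop)
  have h3 := (hc.tendsto X).comp h2
  simpa [Function.comp_def] using h3

lemma IsWignerIntegral.unique (hφ : IsFaithfulTrace φ) (hS : IsFreeBrownianMotion φ S)
    {f : L2 n} {X Y : A} (hX : IsWignerIntegral φ S f X) (hY : IsWignerIntegral φ S f Y) :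
    X = Y := by
  obtain ⟨z, hz, hzf, hzX⟩ := hX
  obtain ⟨w, hw, hwf, hwY⟩ := hY
  have h1 : ∀ j, (φ (star (Y - X) * (Y - X))).re ≤
      3 * ((φ (star ((z j).2 - X) * ((z j).2 - X))).re + ‖(w j).1 - (z j).1‖ ^ 2 +
        (φ (star ((w j).2 - Y) * ((w j).2 - Y))).re) := by
    intro j
    -- `Y - X` is split through the two approximating integrals; the middle difference is controlled
    -- by the isometry. The number of terms gives the factor 3, and faithfulness concludes after the
    -- limit.
    have h2 := hφ.re_map_sum_le Finset.univ
      ![(z j).2 - X, (w j).2 - (z j).2, -((w j).2 - Y)]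
    have h3 := map_star_mul_self_of_mem_stepGraph hφ hS
      ((stepGraph S n).sub_mem (hw j) (hz j))
    rw [Prod.snd_sub, Prod.fst_sub] at h3
    simp only [Fin.sum_univ_three, Matrix.cons_val_zero, Matrix.cons_val_one, Matrix.cons_val,
      star_neg, neg_mul_neg, h3, Complex.ofReal_re, Finset.card_univ, Fintype.card_fin] at h2
    have h4 : (z j).2 - X + ((w j).2 - (z j).2) + -((w j).2 - Y) = Y - X := by abel
    rw [h4] at h2
    exact_mod_cast h2
  have h2 : Tendsto (fun j => 3 * ((φ (star ((z j).2 - X) * ((z j).2 - X))).re +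
      ‖(w j).1 - (z j).1‖ ^ 2 + (φ (star ((w j).2 - Y) * ((w j).2 - Y))).re)) atTop (𝓝 0) := by
    have h3 := (Complex.continuous_re.tendsto 0).comp hzX
    have h4 := (Complex.continuous_re.tendsto 0).comp hwY
    have h5 := ((hwf.sub hzf).norm).pow 2
    simpa using ((h3.add h5).add h4).const_mul 3
  have h3 : (φ (star (Y - X) * (Y - X))).re = 0 :=
    le_antisymm (ge_of_tendsto' h2 h1) (hφ.re_nonneg _)
  have h4 := hφ.faithful (Y - X) (by rw [← hφ.ofReal_re, h3, Complex.ofReal_zero])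
  exact (sub_eq_zero.1 h4).symm

lemma existsUnique_isWignerIntegral (hφ : IsFaithfulTrace φ) (hS : IsFreeBrownianMotion φ S)
    (f : L2 n) : ∃! X, IsWignerIntegral φ S f X := by
  obtain ⟨X, z, hz, h1, h2⟩ := exists_tendsto_stepGraph hφ hS f
  exact ⟨X, isWignerIntegral_of_tendsto hφ hz h1 h2,
    fun Y hY => hY.unique hφ hS (isWignerIntegral_of_tendsto hφ hz h1 h2)⟩

lemma isWignerIntegral_wignerIntegral (hφ : IsFaithfulTrace φ) (hS : IsFreeBrownianMotion φ S)
    (f : L2 n) : IsWignerIntegral φ S f (wignerIntegral φ S f) := by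
  have h := (existsUnique_isWignerIntegral hφ hS f).exists
  rw [wignerIntegral, dif_pos h]
  exact h.choose_spec

lemma continuous_contraction_adjoint (p : ℕ) :
    Continuous fun f : L2 n => contraction p f (adjoint f) :=
  ((contractionL n n p).continuous.clm_apply continuous_adjoint)

/-- The fourth moment of a Wigner integral. -/
lemma map_wignerIntegral_fourth (hφ : IsFaithfulTrace φ) (hS : IsFreeBrownianMotion φ S)
    (hn : 1 ≤ n) (f : L2 n) :
    φ ((wignerIntegral φ S f * star (wignerIntegral φ S f)) ^ 2) = ((2 * ‖f‖ ^ 4 +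
      ∑ p ∈ Finset.Icc 1 (n - 1), ‖contraction p f (adjoint f)‖ ^ 2 : ℝ) : ℂ) := by
  -- By uniqueness any approximating sequence may be used. One converging in operator norm is
  -- chosen, since `(a * star a) ^ 2` is continuous for that norm.
  obtain ⟨X, z, hz, h1, h2⟩ := exists_tendsto_stepGraph hφ hS f
  have hX : wignerIntegral φ S f = X := (isWignerIntegral_wignerIntegral hφ hS f).unique hφ hS
    (isWignerIntegral_of_tendsto hφ hz h1 h2)
  rw [hX]
  have hc1 : Continuous fun a : A => φ ((a * star a) ^ 2) := hφ.continuous.comp (by fun_prop)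
  have hc2 : Continuous fun g : L2 n => ((2 * ‖g‖ ^ 4 +
      ∑ p ∈ Finset.Icc 1 (n - 1), ‖contraction p g (adjoint g)‖ ^ 2 : ℝ) : ℂ) := by
    refine Complex.continuous_ofReal.comp ((continuous_const.mul (continuous_norm.pow 4)).add ?_)
    exact continuous_finsetSum _ fun p _ => (continuous_contraction_adjoint p).norm.pow 2
  refine tendsto_nhds_unique ((hc1.tendsto X).comp h2) ?_
  refine ((hc2.tendsto f).comp h1).congr fun j => ?_
  exact (map_fourth_of_mem_stepGraph hφ hS hn (hz j)).symm

lemma tendsto_sum_sq_norm_iff {κ : Type*} (s : Finset κ) {E : κ → Type*}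
    [∀ p, NormedAddCommGroup (E p)] (c : ∀ p, ℕ → E p) :
    Tendsto (fun k => ∑ p ∈ s, ‖c p k‖ ^ 2) atTop (𝓝 0) ↔
      ∀ p ∈ s, Tendsto (c p) atTop (𝓝 0) := by
  constructor
  · intro h p hp
    have h1 : Tendsto (fun k => ‖c p k‖ ^ 2) atTop (𝓝 0) := by
      refine squeeze_zero (fun k => by positivity) (fun k => ?_) h
      exact Finset.single_le_sum (f := fun p => ‖c p k‖ ^ 2) (fun q _ => by positivity) hp
    have h2 := h1.sqrt
    simp only [Real.sqrt_sq (norm_nonneg _), Real.sqrt_zero] at h2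
    exact tendsto_zero_iff_norm_tendsto_zero.2 h2
  · intro h
    have h1 := tendsto_finsetSum s fun p hp => ((h p hp).norm).pow 2
    simpa using h1

end Wigner

end FreeProb

/-! ### The fourth moment theorem -/

theorem theorem1p6 {A : Type*} [CStarAlgebra A] (φ : A →ₗ[ℂ] ℂ) (hφ : IsFaithfulTrace φ)
    (S : ℝ≥0 → A) (hS : IsFreeBrownianMotion φ S) (n : ℕ) (hn : 1 ≤ n)
    (f : ℕ → L2 n) (hf : ∀ k, ‖f k‖ = 1) :
    (∀ k, ∃! X, IsWignerIntegral φ S (f k) X) ∧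
    (∀ k, φ ((wignerIntegral φ S (f k) * star (wignerIntegral φ S (f k))) ^ 2) =
      2 + ∑ p ∈ Finset.Icc 1 (n - 1), ((‖contraction p (f k) (adjoint (f k))‖ ^ 2 : ℝ) : ℂ)) ∧
    (Tendsto
        (fun k => φ ((wignerIntegral φ S (f k) * star (wignerIntegral φ S (f k))) ^ 2))
        atTop (𝓝 2) ↔
      ∀ p, 1 ≤ p → p ≤ n - 1 →
        Tendsto (fun k => contraction p (f k) (adjoint (f k))) atTop (𝓝 0)) := by
  have hformula : ∀ k, φ ((wignerIntegral φ S (f k) * star (wignerIntegral φ S (f k))) ^ 2) =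
      2 + ((∑ p ∈ Finset.Icc 1 (n - 1), ‖contraction p (f k) (adjoint (f k))‖ ^ 2 : ℝ) : ℂ) := by
    intro k
    rw [map_wignerIntegral_fourth hφ hS hn, hf k]
    push_cast
    ring
  refine ⟨fun k => existsUnique_isWignerIntegral hφ hS (f k), fun k => ?_, ?_⟩
  · rw [hformula k, Complex.ofReal_sum]
  · simp only [hformula]
    have h1 : Tendsto (fun k => (2 : ℂ) + ((∑ p ∈ Finset.Icc 1 (n - 1),
        ‖contraction p (f k) (adjoint (f k))‖ ^ 2 : ℝ) : ℂ)) atTop (𝓝 2) ↔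
        Tendsto (fun k => ∑ p ∈ Finset.Icc 1 (n - 1),
          ‖contraction p (f k) (adjoint (f k))‖ ^ 2) atTop (𝓝 0) := by
      constructor
      · intro h
        have h2 := (Complex.continuous_re.tendsto _).comp (h.sub_const 2)
        simp only [Function.comp_def, add_sub_cancel_left, Complex.ofReal_re, sub_self,
          Complex.zero_re] at h2
        exact h2
      · intro h
        have h2 := ((Complex.continuous_ofReal.tendsto 0).comp h).const_add 2
        simpa [Function.comp_def] using h2
    rw [h1, tendsto_sum_sq_norm_iff _ fun p k => contraction p (f k) (adjoint (f k))]
    simp only [Finset.mem_Icc, and_imp]
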